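/- Let $0\le n<d$, let $\mathcal M\subset\mathbb R^d$ be a compact $n$-dimensional embedded $C^4$ submanifold without boundary, with tangent spaces $T_p\mathcal M$ and normal spaces $N_p\mathcal M=(T_p\mathcal M)^\perp$, and let $\epsilon>0$ be such that $T_{\mathcal M}(\epsilon)=\{x\in\mathbb R^d:\operatorname{dist}(x,\mathcal M)<\epsilon\}$ is a tubular neighbourhood, i.e. $(p,v)\mapsto p+v$ maps $\{(p,v):p\in\mathcal M,\ v\in N_p\mathcal M,\ \|v\|<\epsilon\}$ bijectively onto $T_{\mathcal M}(\epsilon)$. For a function $f_0$ that is $C^2$ on the tube, $p\in\mathcal M$ and $v\in N_p\mathcal M$ with $\|v\|<\epsilon$, let $\partial_r^2 f_0(p,v)$ be the Hessian at $r=v$ of the function $r\mapsto f_0(p+r)$ on the Euclidean space $N_p\mathcal M$ (with the inner product of $\mathbb R^d$), and let $|\partial_r^2 f_0(p,v)|$ be the absolute value of its determinant in an orthonormal basis. Let $f_0,f_1:\mathbb R^d\to\mathbb R$, and let $f_\theta:\mathbb R^d\to\mathbb R$ be functions defined for $\theta>0$. Assume: 1. $\mathcal M$ is the set of minimisers of $f_0$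 over $T_{\mathcal M}(\epsilon)$, and there is $\hat\epsilon\in(0,\epsilon)$ such that $f_0-\min_{T_{\mathcal M}(\epsilon)}f_0$ is bounded below by a positive constant on $T_{\mathcal M}(\epsilon)\setminus\overline{T_{\mathcal M}(\hat\epsilon)}$. 2. $|f_\theta(x)-f_0(x)-\theta f_1(x)|=o(\theta)$ as $\theta\to0^+$, uniformly in $x\in T_{\mathcal M}(\epsilon)$. 3. On $\overline{T_{\mathcal M}(\epsilon)}$, $f_0\ge0$ is $C^3$, $f_1$ is $C^1$, and $f_\theta$ is continuous for all sufficiently small $\theta>0$. 4. The smallest eigenvalue of $\partial_r^2 f_0(p,v)$ is bounded below by a positive constant, uniformly over all $p\in\mathcal M$ and $v\in N_p\mathcal M$ with $\|v\|<\epsilon$. 5. For all sufficiently small $\theta>0$ the function $\exp(-f_\theta/\theta)$ is integrable on $\mathbb R^d$, and the probability densities $$\pi_\theta(x)=\frac{\exp(-f_\theta(x)/\theta)}{\int_{\mathbb R^d}\exp(-f_\theta(y)/\theta)\,dy}$$ satisfy $1-\int_{T_{\mathcal M}(\epsilon)}\pi_\theta(x)\,dx\to0$ as $\theta\to0^+$.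 Then, as $\theta\to0^+$, the probability measures $\pi_\theta(x)\,dx$ converge weakly to the probability measure $\pi$ carried by $\mathcal M$ and given by $$d\pi(p)=\frac{\exp(-f_1(p))\,|\partial_r^2 f_0(p,0)|^{-1/2}\,d\mathcal M(p)}{\int_{\mathcal M}\exp(-f_1(q))\,|\partial_r^2 f_0(q,0)|^{-1/2}\,d\mathcal M(q)},$$ where $d\mathcal M$ is the Riemannian volume measure of $\mathcal M$, i.e. $d\mathcal M=\sqrt{\det g(u)}\,du$ in local coordinates $u$ with metric tensor $g$; the normalising integral is positive and finite. -/

import Mathlib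

open MeasureTheory Filter Topology

noncomputable section

namespace LaplaceManifold

/-- Euclidean space `ℝ^d`. -/
abbrev E (d : ℕ) := EuclideanSpace ℝ (Fin d)

/-- A local parametrisation of class `C^4` of a set `M ⊆ ℝ^d` by an open subset `U = c.source` of
`ℝ^n`: a homeomorphism of `U` onto a relatively open subset of `M` which, as a map into `ℝ^d`,
is `C^4` with injective derivative at each point of `U`. -/
def IsC4Chart {d n : ℕ} {M : Set (E d)} (c : OpenPartialHomeomorph (E n) M) : Prop :=
  ContDiffOn ℝ 4 (fun u => (c u : E d)) c.source ∧
    ∀ u ∈ c.source, Function.Injective (fderiv ℝ (fun u => (c u : E d)) u)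

/-- `M` is an `n`-dimensional embedded `C^4` submanifold (without boundary) of `ℝ^d`. -/
def IsC4Submanifold {d : ℕ} (n : ℕ) (M : Set (E d)) : Prop :=
  ∀ p : M, ∃ c : OpenPartialHomeomorph (E n) M, IsC4Chart c ∧ p ∈ c.target

/-- The tangent space of `M` at `p`: the range of the derivative of a `C^4` local
parametrisation at the parameter of `p` (the range is the same for all parametrisations). -/
def tangentSpace {d : ℕ} (n : ℕ) (M : Set (E d)) (p : E d) : Submodule ℝ (E d) :=
  Submodule.span ℝ {w | ∃ c : OpenPartialHomeomorph (E n) M, IsC4Chart c ∧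
    ∃ u ∈ c.source, (c u : E d) = p ∧ ∃ a : E n, fderiv ℝ (fun u => (c u : E d)) u a = w}

/-- The normal space of `M` at `p`. -/
def normalSpace {d : ℕ} (n : ℕ) (M : Set (E d)) (p : E d) : Submodule ℝ (E d) :=
  (tangentSpace n M p)ᗮ

/-- The open tube `T_M(ε) = {x : dist(x, M) < ε}`. -/
abbrev tube {d : ℕ} (M : Set (E d)) (ε : ℝ) : Set (E d) := Metric.thickening ε M

/-- The disc bundle of radius `ε` in the normal bundle of `M`. -/
def normalDiscBundle {d : ℕ} (n : ℕ) (M : Set (E d)) (ε : ℝ) : Set (E d × E d) :=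
  {q | q.1 ∈ M ∧ q.2 ∈ normalSpace n M q.1 ∧ ‖q.2‖ < ε}

/-- `T_M(ε)` is a tubular neighbourhood: each of its points is `p + v` for exactly one `p ∈ M` and
one normal vector `v` at `p` with `‖v‖ < ε`. -/
def IsTubularRadius {d : ℕ} (n : ℕ) (M : Set (E d)) (ε : ℝ) : Prop :=
  0 < ε ∧ Set.BijOn (fun q : E d × E d => q.1 + q.2) (normalDiscBundle n M ε) (tube M ε)

/-- The Hessian `∂²f/∂r²` at `p + v` in the normal direction: the second derivative at `v` of
`r ↦ f (p + r)`, where `r` ranges over the normal space at `p`. -/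
def normalHessian {d : ℕ} (n : ℕ) (M : Set (E d)) (f : E d → ℝ) (p : E d)
    (v : normalSpace n M p) : normalSpace n M p →L[ℝ] normalSpace n M p →L[ℝ] ℝ :=
  fderiv ℝ (fderiv ℝ (fun r : normalSpace n M p => f (p + r))) v

/-- The determinant of the normal Hessian at the point `p` of `M` (that is, at `r = 0`), computed
in an orthonormal basis of the normal space (its value is the same for all of them). -/
def normalHessianDet {d : ℕ} (n : ℕ) (M : Set (E d)) (f : E d → ℝ) (p : E d) : ℝ :=
  (Matrix.of fun i j =>
    normalHessian n M f p 0 (stdOrthonormalBasis ℝ (normalSpace n M p) i)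
      (stdOrthonormalBasis ℝ (normalSpace n M p) j)).det

/-- The metric tensor `g(u)` of `M` in a local parametrisation. -/
def metricTensor {d n : ℕ} {M : Set (E d)} (c : OpenPartialHomeomorph (E n) M) (u : E n) :
    Matrix (Fin n) (Fin n) ℝ :=
  Matrix.gram ℝ fun i => fderiv ℝ (fun u => (c u : E d)) u (EuclideanSpace.single i 1)

/-- The measure `√(det g(u)) du` of a local parametrisation, as a measure on `ℝ^d` carried by the
parametrised patch of `M`. -/
def chartVolume {d n : ℕ} {M : Set (E d)} (c : OpenPartialHomeomorph (E n) M) : Measure (E d) :=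
  Measure.map (fun u => (c u : E d))
    ((volume.restrict c.source).withDensity fun u => ENNReal.ofReal √(metricTensor c u).det)

/-- The Riemannian volume of `M`, as a measure on `ℝ^d` carried by `M`: the supremum, over all local
parametrisations, of the measures `√(det g(u)) du`. Since these agree on overlaps of patches, it
is the measure whose restriction to each patch is `√(det g(u)) du`. -/
def riemannianVolume {d : ℕ} (n : ℕ) (M : Set (E d)) : Measure (E d) :=
  ⨆ (c : OpenPartialHomeomorph (E n) M) (_ : IsC4Chart c), chartVolume c

/-- The probability density on `ℝ^d` proportional to `exp (-F / θ)`. -/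
def gibbsDensity {d : ℕ} (F : E d → ℝ) (θ : ℝ) (x : E d) : ℝ :=
  Real.exp (-F x / θ) / ∫ y, Real.exp (-F y / θ)

/-- The probability measure with density proportional to `exp (-F / θ)`. -/
def gibbsMeasure {d : ℕ} (F : E d → ℝ) (θ : ℝ) : Measure (E d) :=
  volume.withDensity fun x => ENNReal.ofReal (gibbsDensity F θ x)

/-- `exp (-f₁) |∂²f₀/∂r²|^{-1/2} dM`. -/
def unnormalizedLimit {d : ℕ} (n : ℕ) (M : Set (E d)) (f₀ f₁ : E d → ℝ) : Measure (E d) :=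
  (riemannianVolume n M).withDensity fun p =>
    ENNReal.ofReal (Real.exp (-f₁ p) * |normalHessianDet n M f₀ p| ^ (-(1 / 2) : ℝ))

/-- The measure `exp (-f₁) |∂²f₀/∂r²|^{-1/2} dM`, normalised to total mass one. -/
def limitMeasure {d : ℕ} (n : ℕ) (M : Set (E d)) (f₀ f₁ : E d → ℝ) : Measure (E d) :=
  (unnormalizedLimit n M f₀ f₁ Set.univ)⁻¹ • unnormalizedLimit n M f₀ f₁

end LaplaceManifold

end

/-!
The proof is Laplace's method in tubular coordinates.

Over a small piece of a chart `c` of `M` there is a `C^1` frame `T u : ℝ^k → N_{c u} M` of the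
normal bundle (`IsC4Chart.exists_isNormalFrame`), and `(u, t) ↦ c u + T u t` parametrises the part
of the tube lying over that piece. Its Jacobian at `t = 0` is `√det g(u)` times the Gram factor
`√det (gram (T u))`. Substituting `t = √θ s`, the exponent `(f₀ - min f₀) / θ` tends to half the
normal Hessian at `c u` applied to `T u s`, and the uniform lower bound on the Hessian dominates
the integrand by a Gaussian. So `θ^{-k/2} ∫ g_θ exp (-(f₀ - min f₀) / θ)` over this part of the
tube converges, for `g_θ → g₀` uniformly, to a constant times `∫ g₀ |∂²f₀/∂r²|^{-1/2} √det g du`,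
where the Gram factors of the Jacobian and of the Gaussian integral cancel
(`IsLaplacePotential.tendsto_setIntegral_tubeOver`). The frame need not be orthonormal.

The Riemannian volume is a supremum of chart measures, so it has to be shown that two charts agree
on overlaps. This comes from the same asymptotics: the Laplace integral over the part of the tube
above a set `A ⊆ M` does not refer to a chart, so its limits computed in two charts coincide
(`IsLaplacePotential.chartVolume_restrict_eq_of_isSmall`). Hence the Riemannian volume restricts
to each patch as the chart measure (`IsLaplacePotential.riemannianVolume_restrict_patch`), and by
compactness the local asymptotics add up to those of the whole tube
(`IsLaplacePotential.tendsto_setIntegral_tube`).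

Finally `exp (-f_θ / θ)` is, up to a constant, `exp (-(f₀ - min f₀) / θ)` times a factor
converging uniformly to `exp (-f₁)`, the normalising constants cancel in a quotient of two Laplace
integrals, and the mass outside the tube is negligible
(`IsLaplacePotential.tendsto_integral_gibbsMeasure`).
-/

open MeasureTheory Filter Topology

noncomputable section

namespace LaplaceManifold

section

/-! ### Determinants and Gaussian integrals -/

theorem measurePreserving_finAddEquivProd (n k : ℕ) :
    MeasurePreserving (EuclideanSpace.finAddEquivProd : E (n + k) ≃L[ℝ] E n × E k) := by
  have h1 := (LinearIsometryEquiv.piLpCongrLeft 2 ℝ ℝ (finSumFinEquiv (m := n) (n := k)).symm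
    ).measurePreserving
  have h2 := (PiLp.sumPiLpEquivProdLpPiLp (𝕜 := ℝ) (ι := Fin n) (κ := Fin k) 2
    (fun _ => ℝ)).measurePreserving
  have h3 := WithLp.volume_preserving_ofLp (U := E n) (V := E k)
  exact h3.comp (h2.comp h1)

/-- Change of variables for a map from `ℝ^n × ℝ^k` to `ℝ^(n+k)`. -/
theorem setIntegral_image_prod {n k : ℕ} {Φ : E n × E k → E (n + k)}
    {Φ' : E n × E k → E n × E k →L[ℝ] E (n + k)} {s : Set (E n × E k)}
    (hs : MeasurableSet s)
    (hΦ : ∀ x ∈ s, HasFDerivWithinAt Φ (Φ' x) s x) (hinj : Set.InjOn Φ s) (g : E (n + k) → ℝ) :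
    ∫ y in Φ '' s, g y =
      ∫ x in s, |((Φ' x).comp (EuclideanSpace.finAddEquivProd :
        E (n + k) ≃L[ℝ] E n × E k).toContinuousLinearMap).det| * g (Φ x) := by
  set e : E (n + k) ≃L[ℝ] E n × E k := EuclideanSpace.finAddEquivProd with he
  have hmp : MeasurePreserving e := measurePreserving_finAddEquivProd n k
  have hemb : MeasurableEmbedding e := e.toHomeomorph.measurableEmbedding
  have himg : Φ '' s = (Φ ∘ e) '' (e ⁻¹' s) := by
    rw [Set.image_comp, Set.image_preimage_eq _ e.surjective]
  rw [himg, integral_image_eq_integral_abs_det_fderiv_smul volume (e.continuous.measurable hs)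
    (f' := fun x => (Φ' (e x)).comp e.toContinuousLinearMap) ?_ ?_ g,
    ← hmp.setIntegral_preimage_emb hemb]
  · simp
  · intro x hx
    exact (hΦ (e x) hx).comp x (e.hasFDerivAt.hasFDerivWithinAt) (Set.mapsTo_preimage _ _)
  · intro x hx y hy hxy
    exact e.injective (hinj hx hy hxy)

/-- The matrix `P` is square, but its rows and columns may be indexed by different types. -/
theorem det_mul_mul_transpose {ι κ : Type*} [Fintype ι] [Fintype κ] [DecidableEq ι]
    [DecidableEq κ] (e : κ ≃ ι) (P : Matrix ι κ ℝ) (H : Matrix κ κ ℝ) :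
    (P * H * P.transpose).det = H.det * (P * P.transpose).det := by
  have h : ∀ K : Matrix κ κ ℝ, (P * K * P.transpose).det =
      (P.submatrix e id).det * K.det * (P.submatrix e id).det := by
    intro K
    have : (P * K * P.transpose).submatrix e e =
        P.submatrix e id * K * (P.submatrix e id).transpose := by
      ext i j
      simp [Matrix.mul_apply]
    rw [← Matrix.det_submatrix_equiv_self e, this, Matrix.det_mul, Matrix.det_mul,
      Matrix.det_transpose]
  have h1 := h 1
  rw [Matrix.mul_one, Matrix.det_one] at h1
  rw [h, h1]
  ring

/-- If the ranges of `L` and `T` are orthogonal, then the volume distortion of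
`(a, b) ↦ L a + T b` is the product of the volume distortions of `L` and `T`. -/
theorem abs_det_coprod_finAddEquivProd {n k : ℕ} (L : E n →L[ℝ] E (n + k))
    (T : E k →L[ℝ] E (n + k)) (h : ∀ a b, inner ℝ (L a) (T b) = 0) :
    |((L.coprod T).comp (EuclideanSpace.finAddEquivProd :
        E (n + k) ≃L[ℝ] E n × E k).toContinuousLinearMap).det| =
      √(Matrix.gram ℝ fun i => L (EuclideanSpace.single i 1)).det *
        √(Matrix.gram ℝ fun i => T (EuclideanSpace.single i 1)).det := by
  set e : E (n + k) ≃L[ℝ] E n × E k := EuclideanSpace.finAddEquivProd with he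
  set A := (L.coprod T).comp e.toContinuousLinearMap with hA
  set b := (EuclideanSpace.basisFun (Fin (n + k)) ℝ) with hb
  set Mx := LinearMap.toMatrix b.toBasis b.toBasis (A : E (n + k) →ₗ[ℝ] E (n + k)) with hMx
  have hdet : A.det = Mx.det := by rw [hMx, LinearMap.det_toMatrix]
  have he1 : ∀ x i, (e x).1 i = x (Fin.castAdd k i) := fun _ _ => rfl
  have he2 : ∀ x i, (e x).2 i = x (Fin.natAdd n i) := fun _ _ => rfl
  have hl : ∀ i : Fin n, A (EuclideanSpace.single (finSumFinEquiv (Sum.inl i)) 1) =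
      L (EuclideanSpace.single i 1) := by
    intro i
    have : e (EuclideanSpace.single (finSumFinEquiv (Sum.inl i)) 1) =
        (EuclideanSpace.single i 1, 0) := by
      refine Prod.ext ?_ ?_ <;> ext j <;> simp [he1, he2, Fin.ext_iff]; omega
    rw [hA, ContinuousLinearMap.comp_apply, ContinuousLinearEquiv.coe_coe, this]
    simp
  have hr : ∀ i : Fin k, A (EuclideanSpace.single (finSumFinEquiv (Sum.inr i)) 1) =
      T (EuclideanSpace.single i 1) := by
    intro i
    have : e (EuclideanSpace.single (finSumFinEquiv (Sum.inr i)) 1) =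
        (0, EuclideanSpace.single i 1) := by
      refine Prod.ext ?_ ?_ <;> ext j <;> simp [he1, he2, Fin.ext_iff]; omega
    rw [hA, ContinuousLinearMap.comp_apply, ContinuousLinearEquiv.coe_coe, this]
    simp
  have hgram : (Mx.transpose * Mx).submatrix finSumFinEquiv finSumFinEquiv =
      Matrix.fromBlocks (Matrix.gram ℝ fun i => L (EuclideanSpace.single i 1)) 0 0
        (Matrix.gram ℝ fun i => T (EuclideanSpace.single i 1)) := by
    have h0 : Mx.transpose * Mx = Matrix.gram ℝ fun i => A (EuclideanSpace.single i 1) := by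
      ext i j
      simp [hMx, Matrix.mul_apply, LinearMap.toMatrix_apply, Matrix.gram_apply, hb,
        PiLp.inner_apply, mul_comm]
    rw [h0]
    ext i j
    rcases i with i | i <;> rcases j with j | j <;>
      simp only [Matrix.submatrix_apply, Matrix.gram_apply, Matrix.fromBlocks_apply₁₁,
        Matrix.fromBlocks_apply₁₂, Matrix.fromBlocks_apply₂₁, Matrix.fromBlocks_apply₂₂, hl, hr,
        Matrix.zero_apply, h]
    rw [real_inner_comm, h]
  have hsq : A.det ^ 2 = (Matrix.gram ℝ fun i => L (EuclideanSpace.single i 1)).det *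
      (Matrix.gram ℝ fun i => T (EuclideanSpace.single i 1)).det := by
    rw [← Matrix.det_fromBlocks_zero₂₁ _ 0 _, ← hgram, Matrix.det_submatrix_equiv_self,
      Matrix.det_mul, Matrix.det_transpose, hdet, sq]
  rw [← Real.sqrt_mul (Matrix.posSemidef_gram ℝ _).det_nonneg, ← hsq, Real.sqrt_sq_eq_abs]

theorem bilin_self_eq_dotProduct {k : ℕ} {β : E k →L[ℝ] E k →L[ℝ] ℝ}
    (hsymm : ∀ s t, β s t = β t s) (s : E k) :
    β s s = s.ofLp ⬝ᵥ ((Matrix.of fun i j =>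
      β (EuclideanSpace.single i 1) (EuclideanSpace.single j 1)).mulVec s.ofLp) := by
  have hs : s = ∑ i, s i • EuclideanSpace.single i (1 : ℝ) := by
    ext j; simp [Finset.sum_apply, Pi.single_apply]
  conv_lhs => rw [hs]
  simp [dotProduct, Matrix.mulVec, Finset.mul_sum]
  refine Finset.sum_congr rfl fun i _ => Finset.sum_congr rfl fun j _ => ?_
  rw [hsymm]
  ring

theorem posDef_matrixOf_bilin {k : ℕ} {β : E k →L[ℝ] E k →L[ℝ] ℝ}
    (hsymm : ∀ s t, β s t = β t s) (hpos : ∀ s, s ≠ 0 → 0 < β s s) :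
    (Matrix.of fun i j =>
      β (EuclideanSpace.single i 1) (EuclideanSpace.single j 1)).PosDef := by
  refine Matrix.PosDef.of_dotProduct_mulVec_pos ?_ fun x hx => ?_
  · ext i j; simp [hsymm]
  · have := hpos (WithLp.toLp 2 x) (by simpa using hx)
    rw [bilin_self_eq_dotProduct hsymm] at this
    simpa using this

/-- The Gaussian integral of a positive definite quadratic form. -/
theorem integral_exp_neg_bilin_div_two {k : ℕ} {β : E k →L[ℝ] E k →L[ℝ] ℝ}
    (hsymm : ∀ s t, β s t = β t s) (hpos : ∀ s, s ≠ 0 → 0 < β s s) :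
    ∫ s, Real.exp (-(β s s / 2)) = (∫ s : E k, Real.exp (-(‖s‖ ^ 2 / 2))) /
      √(Matrix.of fun i j => β (EuclideanSpace.single i 1) (EuclideanSpace.single j 1)).det := by
  set S : Matrix (Fin k) (Fin k) ℝ :=
    Matrix.of fun i j => β (EuclideanSpace.single i 1) (EuclideanSpace.single j 1) with hS
  have hβ : ∀ s : E k, β s s = s.ofLp ⬝ᵥ (S.mulVec s.ofLp) := bilin_self_eq_dotProduct hsymm
  have hSpd : S.PosDef := posDef_matrixOf_bilin hsymm hpos
  -- the linear map with matrix `B` turns the quadratic form into the square of the norm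
  obtain ⟨B, hB⟩ : ∃ B : Matrix (Fin k) (Fin k) ℝ, S = star B * B := by
    open scoped MatrixOrder Matrix.Norms.L2Operator in
    exact CStarAlgebra.nonneg_iff_eq_star_mul_self.mp hSpd.posSemidef.nonneg
  have hdetS : S.det = B.det ^ 2 := by
    rw [hB, Matrix.det_mul, Matrix.star_eq_conjTranspose, Matrix.det_conjTranspose, sq]; simp
  have hdetB : B.det ≠ 0 := by
    intro h0
    have := hSpd.det_pos
    rw [hdetS, h0] at this
    simp at this
  set f : E k →ₗ[ℝ] E k := Matrix.toLin (EuclideanSpace.basisFun (Fin k) ℝ).toBasis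
    (EuclideanSpace.basisFun (Fin k) ℝ).toBasis B with hf
  have hfdet : LinearMap.det f = B.det := by rw [hf, LinearMap.det_toLin]
  have hfn : ∀ s, β s s = ‖f s‖ ^ 2 := by
    intro s
    have hfs : (f s).ofLp = B.mulVec s.ofLp := by
      ext j
      simp only [hf, Matrix.toLin_apply, OrthonormalBasis.coe_toBasis,
        EuclideanSpace.basisFun_apply, WithLp.ofLp_sum, WithLp.ofLp_smul, Finset.sum_apply,
        Pi.smul_apply, PiLp.single_apply, smul_eq_mul, mul_ite, mul_one, mul_zero,
        Finset.sum_ite_eq, Finset.mem_univ, if_true]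
      rfl
    rw [hβ, EuclideanSpace.norm_sq_eq, hB]
    simp only [hfs, Real.norm_eq_abs, sq_abs]
    rw [← Matrix.mulVec_mulVec, Matrix.dotProduct_mulVec, Matrix.star_eq_conjTranspose,
      Matrix.conjTranspose_eq_transpose_of_trivial, Matrix.vecMul_transpose]
    simp [dotProduct, sq]
  have hmap := Measure.map_linearMap_addHaar_eq_smul_addHaar volume (hfdet ▸ hdetB)
  have hemb : MeasurableEmbedding f :=
    (LinearEquiv.ofIsUnitDet (v := (EuclideanSpace.basisFun (Fin k) ℝ).toBasis)
      (v' := (EuclideanSpace.basisFun (Fin k) ℝ).toBasis) (f := f)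
      (by rw [LinearMap.det_toMatrix, hfdet]; exact hdetB.isUnit)
      ).toContinuousLinearEquiv.toHomeomorph.measurableEmbedding
  have := hemb.integral_map (μ := volume) fun s : E k => Real.exp (-(‖s‖ ^ 2 / 2))
  rw [hmap, integral_smul_measure] at this
  simp_rw [hfn]
  rw [← this, hfdet, hdetS, Real.sqrt_sq_eq_abs, ENNReal.toReal_ofReal (abs_nonneg _), abs_inv,
    smul_eq_mul, div_eq_inv_mul]

end

section

/-! ### Tangent and normal spaces -/

variable {d n : ℕ} {M : Set (E d)}

theorem IsC4Chart.contDiffAt {c : OpenPartialHomeomorph (E n) M} (hc : IsC4Chart c) {u : E n}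
    (hu : u ∈ c.source) : ContDiffAt ℝ 4 (fun u => (c u : E d)) u :=
  hc.1.contDiffAt (c.open_source.mem_nhds hu)

theorem IsC4Chart.differentiableAt {c : OpenPartialHomeomorph (E n) M} (hc : IsC4Chart c)
    {u : E n} (hu : u ∈ c.source) : DifferentiableAt ℝ (fun u => (c u : E d)) u :=
  (hc.contDiffAt hu).differentiableAt (by norm_num)

/-- A curve in `M` with velocity `w` at a point of a chart `c` is, up to `o(s)`, the image under
`c` of a curve moving by `O(s)`, because `c` is bi-Lipschitz near the point. So `w` is orthogonal
to everything orthogonal to the range of the derivative of `c`. -/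
theorem tangentSpace_eq_range {c : OpenPartialHomeomorph (E n) M} (hc : IsC4Chart c) {u : E n}
    (hu : u ∈ c.source) :
    tangentSpace n M (c u) = (fderiv ℝ (fun u => (c u : E d)) u).range := by
  set L := fderiv ℝ (fun u => (c u : E d)) u with hL
  refine le_antisymm (Submodule.span_le.2 ?_) ?_
  · rintro w ⟨c', hc', u', hu', hcu, a, rfl⟩
    have hcu' : c' u' = c u := Subtype.ext hcu
    rw [SetLike.mem_coe, ← Submodule.orthogonal_orthogonal L.range, Submodule.mem_orthogonal]
    intro v hv
    have hLv : ∀ x, inner ℝ v (L x) = 0 := fun x => by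
      rw [real_inner_comm]
      exact (Submodule.mem_orthogonal _ _).1 hv (L x) ⟨x, rfl⟩
    have hdc : HasFDerivAt (fun u => (c u : E d)) L u := (hc.differentiableAt hu).hasFDerivAt
    obtain ⟨K, -, hK⟩ := L.toLinearMap.exists_antilipschitzWith (LinearMap.ker_eq_bot.2 (hc.2 u hu))
    have h1 : (fun x => inner ℝ v ((c x : E d) - c u)) =o[𝓝 u] fun x => (c x : E d) - c u := by
      have h2 : (fun x => inner ℝ v ((c x : E d) - c u)) =o[𝓝 u] fun x => x - u := by
        have h3 := (innerSL ℝ v).isBigO_comp (fun x => (c x : E d) - c u - L (x - u)) (𝓝 u)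
        refine (h3.trans_isLittleO hdc.isLittleO).congr_left fun x => ?_
        simp only [innerSL_apply_apply, inner_sub_right (𝕜 := ℝ) v _ (L (x - u)), hLv, sub_zero]
      refine h2.trans_isBigO ?_
      have h3 : (fun x => x - u) =O[𝓝 u] fun x => L (x - u) :=
        Asymptotics.IsBigO.of_bound K (Eventually.of_forall fun x => by
          have := hK.le_mul_dist (x - u) 0
          rwa [dist_zero_right, map_zero, dist_zero_right] at this)
      have h4 : (fun x => (c x : E d) - c u - L (x - u)) =o[𝓝 u] fun x => L (x - u) :=
        hdc.isLittleO.trans_isBigO h3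
      have h5 : (fun x => L (x - u)) =O[𝓝 u] fun x => (c x : E d) - c u := by
        simpa using h4.right_isBigO_add
      exact h3.trans h5
    set γ : ℝ → E n := fun s => u' + s • a with hγ
    have hγ0 : γ 0 = u' := by simp [hγ]
    have hγd : HasDerivAt γ a 0 := by
      simpa [hγ] using ((hasDerivAt_id (0 : ℝ)).smul_const a).const_add u'
    have hγc : Tendsto γ (𝓝 0) (𝓝 u') := by simpa [hγ0] using hγd.continuousAt.tendsto
    have hcγ : HasDerivAt (fun s => (c' (γ s) : E d))
        (fderiv ℝ (fun u => (c' u : E d)) u' a) 0 := by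
      have := (hc'.differentiableAt hu').hasFDerivAt
      rw [← hγ0] at this ⊢
      exact this.comp_hasDerivAt (0 : ℝ) hγd
    have hpt : c' u' ∈ c.target := hcu' ▸ c.map_source hu
    have hc'γ : Tendsto (fun s => c' (γ s)) (𝓝 0) (𝓝 (c' u')) :=
      (c'.continuousAt hu').tendsto.comp hγc
    have hφ : Tendsto (fun s => c.symm (c' (γ s))) (𝓝 0) (𝓝 u) := by
      have := (c.continuousAt_symm hpt).tendsto.comp hc'γ
      rwa [hcu', c.left_inv hu] at this
    have hev : ∀ᶠ s in 𝓝 (0 : ℝ), c (c.symm (c' (γ s))) = c' (γ s) :=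
      (hc'γ.eventually (c.open_target.mem_nhds hpt)).mono fun s hs => c.right_inv hs
    have h4 : (fun s => inner ℝ v ((c' (γ s) : E d) - c u)) =o[𝓝 0] fun s : ℝ => s := by
      have h5 : (fun s => inner ℝ v ((c' (γ s) : E d) - c u)) =o[𝓝 0]
          fun s : ℝ => (c' (γ s) : E d) - c u :=
        (h1.comp_tendsto hφ).congr' (hev.mono fun s hs => by simp [hs])
          (hev.mono fun s hs => by simp [hs])
      refine h5.trans_isBigO ?_
      simpa [hγ0, hcu'] using hcγ.isBigO_sub
    have h6 : HasDerivAt (fun s => inner ℝ v (c' (γ s) : E d)) 0 0 := by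
      rw [hasDerivAt_iff_isLittleO]
      simpa [hγ0, hcu', inner_sub_right] using h4
    have h7 : HasDerivAt (fun s => inner ℝ v (c' (γ s) : E d))
        (inner ℝ v (fderiv ℝ (fun u => (c' u : E d)) u' a)) 0 :=
      (innerSL ℝ v).hasFDerivAt.comp_hasDerivAt (0 : ℝ) hcγ
    exact h7.unique h6
  · rintro _ ⟨a, rfl⟩
    exact Submodule.subset_span ⟨c, hc, u, hu, rfl, a, rfl⟩

theorem mem_normalSpace_iff {c : OpenPartialHomeomorph (E n) M} (hc : IsC4Chart c) {u : E n}
    (hu : u ∈ c.source) {v : E d} :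
    v ∈ normalSpace n M (c u) ↔ ∀ a, inner ℝ (fderiv ℝ (fun u => (c u : E d)) u a) v = 0 := by
  rw [normalSpace, tangentSpace_eq_range hc hu, Submodule.mem_orthogonal]
  exact ⟨fun h a => h _ ⟨a, rfl⟩, by rintro h _ ⟨a, rfl⟩; exact h a⟩

theorem finrank_normalSpace {k : ℕ} {M : Set (E (n + k))} {c : OpenPartialHomeomorph (E n) M}
    (hc : IsC4Chart c) {u : E n} (hu : u ∈ c.source) :
    Module.finrank ℝ (normalSpace n M (c u)) = k := by
  have h := (tangentSpace n M (c u : E (n + k))).finrank_add_finrank_orthogonal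
  have h2 : Module.finrank ℝ (tangentSpace n M (c u : E (n + k))) = n := by
    rw [tangentSpace_eq_range hc hu, LinearMap.finrank_range_of_inj (hc.2 u hu)]
    simp
  rw [h2, finrank_euclideanSpace, Fintype.card_fin] at h
  rw [normalSpace]
  omega

theorem add_mem_tube {ε : ℝ} {p v : E d} (hp : p ∈ M) (hv : ‖v‖ < ε) : p + v ∈ tube M ε :=
  Metric.mem_thickening_iff.2 ⟨p, hp, by simpa [dist_eq_norm] using hv⟩

/-! ### The normal Hessian -/

theorem normalHessian_apply {ε : ℝ} {f : E d → ℝ} (hf : ContDiffOn ℝ 2 f (tube M ε)) {p : E d}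
    (hp : p ∈ M) (v : normalSpace n M p) (hv : ‖v‖ < ε) (w w' : normalSpace n M p) :
    normalHessian n M f p v w w' = fderiv ℝ (fderiv ℝ f) (p + v) w w' := by
  have hopen : IsOpen (tube M ε) := Metric.isOpen_thickening
  have hat : ∀ r : normalSpace n M p, ‖r‖ < ε → ContDiffAt ℝ 2 f (p + r) := fun r hr =>
    hf.contDiffAt (hopen.mem_nhds (add_mem_tube hp (by simpa using hr)))
  have hι : ∀ r : normalSpace n M p, HasFDerivAt (fun r : normalSpace n M p => p + (r : E d))
      (normalSpace n M p).subtypeL r := fun r =>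
    (normalSpace n M p).subtypeL.hasFDerivAt.const_add p
  have h1 : fderiv ℝ (fun r : normalSpace n M p => f (p + r)) =ᶠ[𝓝 v]
      fun r => (fderiv ℝ f (p + r)).comp (normalSpace n M p).subtypeL := by
    filter_upwards [(isOpen_lt continuous_norm continuous_const).mem_nhds hv] with r hr
    exact (((hat r hr).differentiableAt (by norm_num)).hasFDerivAt.comp r (hι r)).fderiv
  have h2 : HasFDerivAt (fderiv ℝ f) (fderiv ℝ (fderiv ℝ f) (p + v)) (p + (v : E d)) :=
    (((hat v hv).fderiv_right (m := 1) (by norm_num)).differentiableAt (by norm_num)).hasFDerivAt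
  have h3 := (h2.comp v (hι v)).clm_comp (hasFDerivAt_const (normalSpace n M p).subtypeL v)
  rw [normalHessian, h1.fderiv_eq]
  erw [h3.fderiv]
  simp

/-- A lower bound `κ` for the second derivative along a segment starting at a critical point. -/
theorem half_le_sub_of_le_fderiv_fderiv {V : Type*} [NormedAddCommGroup V] [NormedSpace ℝ V]
    {f : V → ℝ} {U : Set V} (hU : IsOpen U) (hf : ContDiffOn ℝ 2 f U) {p v : V} {κ : ℝ}
    (hseg : ∀ s ∈ Set.Icc (0 : ℝ) 1, p + s • v ∈ U) (hcrit : fderiv ℝ f p v = 0)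
    (hκ : ∀ s ∈ Set.Icc (0 : ℝ) 1, κ ≤ fderiv ℝ (fderiv ℝ f) (p + s • v) v v) :
    κ / 2 ≤ f (p + v) - f p := by
  have hat : ∀ s ∈ Set.Icc (0 : ℝ) 1, ContDiffAt ℝ 2 f (p + s • v) := fun s hs =>
    hf.contDiffAt (hU.mem_nhds (hseg s hs))
  have hγ : ∀ s : ℝ, HasDerivAt (fun s : ℝ => p + s • v) v s := fun s => by
    simpa using ((hasDerivAt_id s).smul_const v).const_add p
  have h1 : ∀ s ∈ Set.Icc (0 : ℝ) 1, HasDerivAt (fun s : ℝ => f (p + s • v) - κ / 2 * s ^ 2)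
      (fderiv ℝ f (p + s • v) v - κ * s) s := fun s hs => by
    have := ((hat s hs).differentiableAt (by norm_num)).hasFDerivAt.comp_hasDerivAt s (hγ s)
    refine (this.sub ((hasDerivAt_pow 2 s).const_mul (κ / 2))).congr_deriv ?_
    push_cast; ring
  have h2 : ∀ s ∈ Set.Icc (0 : ℝ) 1, HasDerivAt (fun s : ℝ => fderiv ℝ f (p + s • v) v - κ * s)
      (fderiv ℝ (fderiv ℝ f) (p + s • v) v v - κ) s := fun s hs => by
    have h3 := (((hat s hs).fderiv_right (m := 1) (by norm_num)).differentiableAt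
      (by norm_num)).hasFDerivAt.comp_hasDerivAt s (hγ s)
    have h4 := h3.clm_apply (hasDerivAt_const s v)
    refine (h4.sub ((hasDerivAt_id s).const_mul κ)).congr_deriv ?_
    simp
  have hm2 : MonotoneOn (fun s : ℝ => fderiv ℝ f (p + s • v) v - κ * s) (Set.Icc 0 1) := by
    refine monotoneOn_of_deriv_nonneg (convex_Icc 0 1)
      (fun s hs => (h2 s hs).continuousAt.continuousWithinAt)
      (fun s hs => (h2 s (interior_subset hs)).differentiableAt.differentiableWithinAt)
      fun s hs => ?_
    rw [(h2 s (interior_subset hs)).deriv]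
    linarith [hκ s (interior_subset hs)]
  have hm1 : MonotoneOn (fun s : ℝ => f (p + s • v) - κ / 2 * s ^ 2) (Set.Icc 0 1) := by
    refine monotoneOn_of_deriv_nonneg (convex_Icc 0 1)
      (fun s hs => (h1 s hs).continuousAt.continuousWithinAt)
      (fun s hs => (h1 s (interior_subset hs)).differentiableAt.differentiableWithinAt)
      fun s hs => ?_
    rw [(h1 s (interior_subset hs)).deriv]
    have := hm2 (Set.left_mem_Icc.2 zero_le_one) (interior_subset hs) (interior_subset hs).1
    simpa [hcrit] using this
  have := hm1 (Set.left_mem_Icc.2 zero_le_one) (Set.right_mem_Icc.2 zero_le_one) zero_le_one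
  simp only [zero_smul, one_smul, add_zero] at this
  linarith

/-- The second-order expansion at a critical point, along the parabolic scaling `√θ`. -/
theorem tendsto_div_of_fderiv_eq_zero {V : Type*} [NormedAddCommGroup V] [NormedSpace ℝ V]
    {f : V → ℝ} {p v : V} (hf : ContDiffAt ℝ 2 f p) (hcrit : fderiv ℝ f p v = 0) :
    Tendsto (fun θ : ℝ => (f (p + √θ • v) - f p) / θ) (𝓝[>] 0)
      (𝓝 (fderiv ℝ (fderiv ℝ f) p v v / 2)) := by
  have hγ : ∀ s : ℝ, HasDerivAt (fun s : ℝ => p + s • v) v s := fun s => by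
    simpa using ((hasDerivAt_id s).smul_const v).const_add p
  have hγ0 : Tendsto (fun s : ℝ => p + s • v) (𝓝 0) (𝓝 p) := by
    simpa using (hγ 0).continuousAt.tendsto
  have h1 : ∀ᶠ s in 𝓝 (0 : ℝ), HasDerivAt (fun s : ℝ => f (p + s • v) - f p)
      (fderiv ℝ f (p + s • v) v) s := by
    filter_upwards [hγ0.eventually (hf.eventually (by norm_num))] with s hs
    exact ((hs.differentiableAt (by norm_num)).hasFDerivAt.comp_hasDerivAt s (hγ s)).sub_const _
  have h2 : HasDerivAt (fun s : ℝ => fderiv ℝ f (p + s • v) v)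
      (fderiv ℝ (fderiv ℝ f) p v v) 0 := by
    have h3 : HasFDerivAt (fderiv ℝ f) (fderiv ℝ (fderiv ℝ f) p) p :=
      ((hf.fderiv_right (m := 1) (by norm_num)).differentiableAt (by norm_num)).hasFDerivAt
    have h4 : HasFDerivAt (fun x => fderiv ℝ f x v)
        ((fderiv ℝ (fderiv ℝ f) p).flip v) (p + (0 : ℝ) • v) := by
      rw [zero_smul, add_zero]
      exact (ContinuousLinearMap.apply ℝ ℝ v).hasFDerivAt.comp p h3
    exact h4.comp_hasDerivAt (0 : ℝ) (hγ 0)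
  have h4 : Tendsto (fun s : ℝ => (f (p + s • v) - f p) / s ^ 2) (𝓝[>] 0)
      (𝓝 (fderiv ℝ (fderiv ℝ f) p v v / 2)) := by
    refine HasDerivAt.lhopital_zero_nhdsGT (g' := fun s => 2 * s)
      (h1.filter_mono nhdsWithin_le_nhds)
      (Eventually.of_forall fun s => by simpa using hasDerivAt_pow 2 s) ?_ ?_ ?_ ?_
    · filter_upwards [self_mem_nhdsWithin] with s hs
      simpa using (ne_of_gt hs)
    · have := h1.self_of_nhds.continuousAt.tendsto
      simp only [zero_smul, add_zero, sub_self] at this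
      exact this.mono_left nhdsWithin_le_nhds
    · have : Tendsto (fun s : ℝ => s ^ 2) (𝓝 0) (𝓝 (0 ^ 2)) := (continuous_pow 2).tendsto 0
      simpa using this.mono_left nhdsWithin_le_nhds
    · have h5 := (hasDerivAt_iff_tendsto_slope.1 h2).mono_left
        (nhdsWithin_mono 0 fun s (hs : 0 < s) => ne_of_gt hs)
      refine (h5.div_const 2).congr fun s => ?_
      simp only [slope_def_field, zero_smul, add_zero, hcrit, sub_zero]
      rw [div_div, mul_comm]
  have h6 : Tendsto (fun θ : ℝ => √θ) (𝓝[>] 0) (𝓝[>] 0) := by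
    refine tendsto_nhdsWithin_iff.2 ⟨?_, ?_⟩
    · have := (Real.continuous_sqrt.tendsto 0).mono_left (nhdsWithin_le_nhds (s := Set.Ioi 0))
      simpa using this
    · filter_upwards [self_mem_nhdsWithin] with θ hθ using Real.sqrt_pos.2 hθ
  refine (h4.comp h6).congr' ?_
  filter_upwards [self_mem_nhdsWithin] with θ hθ
  simp only [Function.comp_apply, Real.sq_sqrt (le_of_lt hθ)]

/-- In a frame `T` of the normal space, not necessarily orthonormal, the determinant of the
Hessian is multiplied by the Gram determinant of the frame. -/
theorem det_fderiv_fderiv_eq {k : ℕ} {M : Set (E (n + k))} {ε : ℝ} (hε : 0 < ε)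
    {f : E (n + k) → ℝ} (hf : ContDiffOn ℝ 2 f (tube M ε))
    {c : OpenPartialHomeomorph (E n) M} (hc : IsC4Chart c) {u : E n} (hu : u ∈ c.source)
    (T : E k →L[ℝ] E (n + k)) (hT : ∀ t, T t ∈ normalSpace n M (c u)) :
    (Matrix.of fun i j => fderiv ℝ (fderiv ℝ f) (c u : E (n + k))
      (T (EuclideanSpace.single i 1)) (T (EuclideanSpace.single j 1))).det =
    normalHessianDet n M f (c u) *
      (Matrix.gram ℝ fun i => T (EuclideanSpace.single i 1)).det := by
  set N := normalSpace n M (c u : E (n + k)) with hN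
  set b := stdOrthonormalBasis ℝ N with hb
  have hrank : Module.finrank ℝ N = k := finrank_normalSpace hc hu
  set P : Matrix (Fin k) (Fin (Module.finrank ℝ N)) ℝ :=
    Matrix.of fun i a => inner ℝ (b a) (⟨T (EuclideanSpace.single i 1), hT _⟩ : N) with hP
  have hTP : ∀ i, T (EuclideanSpace.single i 1) = ∑ a, P i a • (b a : E (n + k)) := by
    intro i
    have := congrArg (Subtype.val) (b.sum_repr' (⟨T (EuclideanSpace.single i 1), hT _⟩ : N))
    simpa [hP] using this.symm
  have hH : (Matrix.of fun i j => fderiv ℝ (fderiv ℝ f) (c u : E (n + k))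
      (T (EuclideanSpace.single i 1)) (T (EuclideanSpace.single j 1))) =
      P * (Matrix.of fun i j => normalHessian n M f (c u) 0 (b i) (b j)) * P.transpose := by
    ext i j
    have h0 : ∀ w w' : N, normalHessian n M f (c u) 0 w w' =
        fderiv ℝ (fderiv ℝ f) (c u : E (n + k)) w w' := fun w w' => by
      simpa using normalHessian_apply hf (c u).2 (0 : N) (by simpa using hε) w w'
    simp only [Matrix.of_apply, Matrix.mul_apply, Matrix.transpose_apply, h0]
    rw [hTP i, hTP j]
    simp only [map_sum, map_smul, sum_apply, smul_apply,
      smul_eq_mul, Finset.sum_mul, Finset.mul_sum]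
    refine Finset.sum_congr rfl fun x _ => Finset.sum_congr rfl fun y _ => ?_
    ring
  have hG : (Matrix.gram ℝ fun i => T (EuclideanSpace.single i 1)) = P * P.transpose := by
    ext i j
    simp only [Matrix.gram_apply, Matrix.mul_apply, Matrix.transpose_apply]
    have : inner ℝ (T (EuclideanSpace.single i 1)) (T (EuclideanSpace.single j 1)) =
      inner ℝ (⟨T (EuclideanSpace.single i 1), hT _⟩ : N) ⟨T (EuclideanSpace.single j 1), hT _⟩ :=
      rfl
    rw [this, ← b.sum_inner_mul_inner]
    refine Finset.sum_congr rfl fun a _ => ?_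
    rw [hP, Matrix.of_apply, Matrix.of_apply, real_inner_comm]
  rw [hH, hG, det_mul_mul_transpose (finCongr hrank)]
  rfl

end

section

/-! ### Local frames of the normal bundle -/

/-- A `C^1` frame of the normal bundle over the part `c '' O` of a chart, given as a family of
linear isomorphisms `T u` of `ℝ^k` onto the normal space at `c u`. Orthonormality is not asked for,
only the bound `‖t‖ ≤ ‖T u t‖`. -/
structure IsNormalFrame {n k : ℕ} {M : Set (E (n + k))} (c : OpenPartialHomeomorph (E n) M)
    (O : Set (E n)) (T : E n → E k →L[ℝ] E (n + k)) : Prop where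
  isOpen : IsOpen O
  subset_source : O ⊆ c.source
  contDiffOn : ContDiffOn ℝ 1 T O
  mem_normalSpace : ∀ u ∈ O, ∀ t, T u t ∈ normalSpace n M (c u)
  norm_le : ∀ u ∈ O, ∀ t, ‖t‖ ≤ ‖T u t‖
  surj : ∀ u ∈ O, ∀ w ∈ normalSpace n M (c u), ∃ t, T u t = w

variable {n k : ℕ} {M : Set (E (n + k))} {c : OpenPartialHomeomorph (E n) M}

/-- The frame at `u` is obtained from an orthonormal frame at `u₀` by subtracting the element of
the tangent space at `u₀` which makes the result normal at `u`. The component normal at `u₀` is not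
changed, so norms do not decrease. -/
theorem IsC4Chart.exists_isNormalFrame (hc : IsC4Chart c) {u₀ : E n} (hu₀ : u₀ ∈ c.source) :
    ∃ O T, u₀ ∈ O ∧ IsNormalFrame c O T := by
  set D : E n → E n →L[ℝ] E (n + k) := fderiv ℝ (fun u => (c u : E (n + k))) with hD
  have hDc : ContDiffOn ℝ 1 D c.source := hc.1.fderiv_of_isOpen c.open_source (by norm_num)
  let adjₗ : (E n →L[ℝ] E (n + k)) →ₗ[ℝ] (E (n + k) →L[ℝ] E n) :=
    { toFun := fun L => ContinuousLinearMap.adjoint L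
      map_add' := fun L L' => map_add _ L L'
      map_smul' := fun r L => by simp }
  let A : (E n →L[ℝ] E (n + k)) →L[ℝ] (E (n + k) →L[ℝ] E n) :=
    LinearMap.toContinuousLinearMap adjₗ
  have hA : ∀ L x a, inner ℝ (L a) x = inner ℝ a (A L x) := fun L x a =>
    (ContinuousLinearMap.adjoint_inner_right L a x).symm
  set G : E n → E n →L[ℝ] E n := fun u => (A (D u)).comp (D u₀) with hG
  have hAD : ContDiffOn ℝ 1 (fun u => A (D u)) c.source := A.contDiff.comp_contDiffOn hDc
  have hGc : ContDiffOn ℝ 1 G c.source := hAD.clm_comp contDiffOn_const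
  set O : Set (E n) := c.source ∩ G ⁻¹' {x | IsUnit x} with hO
  have hOopen : IsOpen O := hGc.continuousOn.isOpen_inter_preimage c.open_source Units.isOpen
  -- at `u₀` this is `L* L` with `L` injective
  have hG₀ : IsUnit (G u₀) := by
    have hinj : Function.Injective (G u₀) := by
      refine (injective_iff_map_eq_zero _).2 fun a ha => ?_
      have h1 : inner ℝ (D u₀ a) (D u₀ a) = 0 := by
        rw [hA]
        change inner ℝ a (G u₀ a) = 0
        rw [ha, inner_zero_right]
      exact hc.2 u₀ hu₀ (by rw [map_zero]; exact inner_self_eq_zero.1 h1)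
    exact ContinuousLinearMap.isUnit_iff_bijective.2
      ⟨hinj, LinearMap.injective_iff_surjective (f := (G u₀).toLinearMap).1 hinj⟩
  set N₀ := normalSpace n M (c u₀ : E (n + k)) with hN₀
  set e : E k ≃ₗᵢ[ℝ] N₀ :=
    ((stdOrthonormalBasis ℝ N₀).reindex (finCongr (finrank_normalSpace hc hu₀))).repr.symm with he
  set j : E k →L[ℝ] E (n + k) := N₀.subtypeL.comp e.toContinuousLinearEquiv.toContinuousLinearMap
    with hj
  have hjmem : ∀ t, j t ∈ N₀ := fun t => (e t).2
  have hjnorm : ∀ t, ‖j t‖ = ‖t‖ := fun t => e.norm_map t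
  set T : E n → E k →L[ℝ] E (n + k) := fun u =>
    j - (D u₀).comp ((Ring.inverse (G u)).comp ((A (D u)).comp j)) with hT
  have hTapp : ∀ u t, T u t = j t - D u₀ (Ring.inverse (G u) (A (D u) (j t))) := fun _ _ => rfl
  -- Pythagoras: what is subtracted from `j t` is tangent at `u₀`, while `j t` is normal there
  have hnorm : ∀ u t, ‖t‖ ≤ ‖T u t‖ := by
    intro u t
    rw [hTapp, ← hjnorm t]
    set b := Ring.inverse (G u) (A (D u) (j t))
    have h1 : inner ℝ (j t) (D u₀ b) = 0 := by
      rw [real_inner_comm]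
      exact (mem_normalSpace_iff hc hu₀).1 (hjmem t) b
    have h2 := norm_sub_sq_real (j t) (D u₀ b)
    rw [h1] at h2
    exact le_of_sq_le_sq (by nlinarith [sq_nonneg ‖D u₀ b‖]) (norm_nonneg _)
  have hmem : ∀ u ∈ O, ∀ t, T u t ∈ normalSpace n M (c u) := by
    intro u hu t
    refine (mem_normalSpace_iff hc hu.1).2 fun a => ?_
    have h1 : A (D u) (T u t) = 0 := by
      rw [hTapp, map_sub]
      have h2 : G u (Ring.inverse (G u) (A (D u) (j t))) = A (D u) (j t) := by
        have := Ring.mul_inverse_cancel (G u) hu.2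
        exact congrArg (fun f : E n →L[ℝ] E n => f (A (D u) (j t))) this
      exact sub_eq_zero.2 h2.symm
    rw [hA, h1, inner_zero_right]
  refine ⟨O, T, ⟨hu₀, hG₀⟩, hOopen, Set.inter_subset_left, ?_, hmem, fun u _ t => hnorm u t, ?_⟩
  · have hinv : ContDiffOn ℝ 1 (fun u => Ring.inverse (G u)) O := by
      intro u hu
      obtain ⟨x, hx⟩ := hu.2
      have h1 : ContDiffAt ℝ 1 Ring.inverse (G u) := hx ▸ contDiffAt_ringInverse ℝ x
      exact h1.comp_contDiffWithinAt u ((hGc u hu.1).mono Set.inter_subset_left)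
    exact contDiffOn_const.sub (contDiffOn_const.clm_comp (hinv.clm_comp
      ((hAD.mono Set.inter_subset_left).clm_comp contDiffOn_const)))
  · intro u hu w hw
    set Tu : E k →ₗ[ℝ] normalSpace n M (c u : E (n + k)) :=
      (T u).toLinearMap.codRestrict _ (hmem u hu) with hTu
    have hinj : Function.Injective Tu := by
      refine (injective_iff_map_eq_zero _).2 fun t ht => ?_
      have h1 : T u t = 0 := congrArg Subtype.val ht
      have h2 := hnorm u t
      rw [h1, norm_zero] at h2
      exact norm_le_zero_iff.1 h2
    have hrank : Module.finrank ℝ (E k) = Module.finrank ℝ (normalSpace n M (c u : E (n + k))) := by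
      rw [finrank_normalSpace hc hu.1]; simp
    obtain ⟨t, ht⟩ :=
      (LinearMap.injective_iff_surjective_of_finrank_eq_finrank hrank).1 hinj ⟨w, hw⟩
    exact ⟨t, congrArg Subtype.val ht⟩

end

section

/-! ### Tubular coordinates -/

/-- The part of the tube lying over `A ⊆ M`: the points `p + v` with `p ∈ A` and `v` normal at `p`
of norm less than `ε`. -/
def tubeOver {d : ℕ} (n : ℕ) (M : Set (E d)) (ε : ℝ) (A : Set (E d)) : Set (E d) :=
  (fun q : E d × E d => q.1 + q.2) '' {q ∈ normalDiscBundle n M ε | q.1 ∈ A}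

/-- The tubular coordinates `(u, t) ↦ c u + T u t`. -/
def tubeMap {n k : ℕ} {M : Set (E (n + k))} (c : OpenPartialHomeomorph (E n) M)
    (T : E n → E k →L[ℝ] E (n + k)) (x : E n × E k) : E (n + k) :=
  c x.1 + T x.1 x.2

/-- The absolute Jacobian determinant of the tubular coordinates, where `ℝ^n × ℝ^k` is identified
with `ℝ^(n+k)` by concatenation. -/
def tubeJacobian {n k : ℕ} {M : Set (E (n + k))} (c : OpenPartialHomeomorph (E n) M)
    (T : E n → E k →L[ℝ] E (n + k)) (x : E n × E k) : ℝ :=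
  |((fderiv ℝ (tubeMap c T) x).comp (EuclideanSpace.finAddEquivProd :
    E (n + k) ≃L[ℝ] E n × E k).toContinuousLinearMap).det|

/-- The points `(u, t)` with `u ∈ B` that tubular coordinates map into the tube of radius `ε`. -/
def tubeDomain {n k : ℕ} (T : E n → E k →L[ℝ] E (n + k)) (ε : ℝ) (B : Set (E n)) :
    Set (E n × E k) :=
  {x | x.1 ∈ B ∧ ‖T x.1 x.2‖ < ε}

variable {n k : ℕ} {M : Set (E (n + k))} {c : OpenPartialHomeomorph (E n) M} {ε : ℝ}
  {O B : Set (E n)} {T : E n → E k →L[ℝ] E (n + k)}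

theorem IsNormalFrame.contDiffOn_tubeMap (hT : IsNormalFrame c O T) (hc : IsC4Chart c) :
    ContDiffOn ℝ 1 (tubeMap c T) (O ×ˢ Set.univ) := by
  have h1 : ContDiffOn ℝ 1 (fun x : E n × E k => (c x.1 : E (n + k))) (O ×ˢ Set.univ) :=
    (hc.1.of_le (by norm_num)).comp contDiff_fst.contDiffOn
      fun x hx => hT.subset_source hx.1
  have h2 : ContDiffOn ℝ 1 (fun x : E n × E k => T x.1) (O ×ˢ Set.univ) :=
    hT.contDiffOn.comp contDiff_fst.contDiffOn fun x hx => hx.1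
  exact h1.add (h2.clm_apply contDiff_snd.contDiffOn)

theorem IsNormalFrame.isOpen_prod (hT : IsNormalFrame c O T) :
    IsOpen (O ×ˢ (Set.univ : Set (E k))) := hT.isOpen.prod isOpen_univ

theorem IsNormalFrame.hasFDerivAt_tubeMap (hT : IsNormalFrame c O T) (hc : IsC4Chart c)
    {x : E n × E k} (hx : x.1 ∈ O) :
    HasFDerivAt (tubeMap c T) (fderiv ℝ (tubeMap c T) x) x :=
  (((hT.contDiffOn_tubeMap hc).contDiffAt (hT.isOpen_prod.mem_nhds ⟨hx, trivial⟩)).differentiableAt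
    (by norm_num)).hasFDerivAt

theorem IsNormalFrame.continuousOn_tubeJacobian (hT : IsNormalFrame c O T) (hc : IsC4Chart c) :
    ContinuousOn (tubeJacobian c T) (O ×ˢ Set.univ) := by
  have h1 := (hT.contDiffOn_tubeMap hc).continuousOn_fderiv_of_isOpen hT.isOpen_prod (by norm_num)
  exact (ContinuousLinearMap.continuous_det.comp_continuousOn
    (h1.clm_comp continuousOn_const)).abs

theorem IsNormalFrame.tubeJacobian_zero (hT : IsNormalFrame c O T) (hc : IsC4Chart c) {u : E n}
    (hu : u ∈ O) :
    tubeJacobian c T (u, 0) =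
      √(metricTensor c u).det * √(Matrix.gram ℝ fun i => T u (EuclideanSpace.single i 1)).det := by
  have h1 : HasFDerivAt (fun x : E n × E k => (c x.1 : E (n + k)))
      ((fderiv ℝ (fun u => (c u : E (n + k))) u).comp (ContinuousLinearMap.fst ℝ (E n) (E k)))
      (u, 0) :=
    HasFDerivAt.comp (f := (Prod.fst : E n × E k → E n)) (u, (0 : E k))
      (hc.differentiableAt (hT.subset_source hu)).hasFDerivAt hasFDerivAt_fst
  have h2 : HasFDerivAt (fun x : E n × E k => T x.1)
      ((fderiv ℝ T u).comp (ContinuousLinearMap.fst ℝ (E n) (E k))) (u, 0) :=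
    HasFDerivAt.comp (f := (Prod.fst : E n × E k → E n)) (u, (0 : E k))
      ((hT.contDiffOn.contDiffAt (hT.isOpen.mem_nhds hu)).differentiableAt
        (by norm_num)).hasFDerivAt hasFDerivAt_fst
  have h3 := h1.add (h2.clm_apply (hasFDerivAt_snd (𝕜 := ℝ) (p := (u, (0 : E k)))))
  have h4 : fderiv ℝ (tubeMap c T) (u, 0) =
      (fderiv ℝ (fun u => (c u : E (n + k))) u).coprod (T u) := by
    have h5 : HasFDerivAt (tubeMap c T) _ (u, 0) := h3
    rw [h5.fderiv]
    ext x <;> simp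
  rw [tubeJacobian, h4, abs_det_coprod_finAddEquivProd]
  · rfl
  · intro a b
    exact (mem_normalSpace_iff hc (hT.subset_source hu)).1 (hT.mem_normalSpace u hu b) a

theorem tubeMap_mem_tube {x : E n × E k}
    (hx : x ∈ tubeDomain T ε O) : tubeMap c T x ∈ tube M ε :=
  add_mem_tube (c x.1).2 hx.2

theorem IsNormalFrame.injOn_tubeMap (hT : IsNormalFrame c O T) (hε : IsTubularRadius n M ε) :
    Set.InjOn (tubeMap c T) (tubeDomain T ε O) := by
  intro x hx y hy hxy
  have hmem : ∀ z ∈ tubeDomain T ε O,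
      ((c z.1 : E (n + k)), T z.1 z.2) ∈ normalDiscBundle n M ε := fun z hz =>
    ⟨(c z.1).2, hT.mem_normalSpace _ hz.1 _, hz.2⟩
  have h : ((c x.1 : E (n + k)), T x.1 x.2) = ((c y.1 : E (n + k)), T y.1 y.2) :=
    hε.2.injOn (hmem x hx) (hmem y hy) (by simpa only [tubeMap] using hxy)
  have h1 : x.1 = y.1 := c.injOn (hT.subset_source hx.1) (hT.subset_source hy.1)
    (Subtype.ext (congrArg Prod.fst h))
  have h2 : T x.1 x.2 = T y.1 y.2 := congrArg Prod.snd h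
  refine Prod.ext h1 (sub_eq_zero.1 (norm_le_zero_iff.1 ?_))
  refine (hT.norm_le x.1 hx.1 _).trans ?_
  rw [map_sub, h2, h1, sub_self, norm_zero]

theorem IsNormalFrame.tubeOver_image (hT : IsNormalFrame c O T) (hB : B ⊆ O) :
    tubeOver n M ε ((fun u => (c u : E (n + k))) '' B) = tubeMap c T '' tubeDomain T ε B := by
  ext y
  constructor
  · rintro ⟨⟨p, v⟩, ⟨⟨-, hv, hvε⟩, u, hu, rfl⟩, rfl⟩
    obtain ⟨t, rfl⟩ := hT.surj u (hB hu) v hv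
    exact ⟨(u, t), ⟨hu, hvε⟩, rfl⟩
  · rintro ⟨x, hx, rfl⟩
    exact ⟨(c x.1, T x.1 x.2), ⟨⟨(c x.1).2, hT.mem_normalSpace _ (hB hx.1) _, hx.2⟩,
      x.1, hx.1, rfl⟩, rfl⟩

theorem tubeDomain_mono (hB : B ⊆ O) : tubeDomain T ε B ⊆ tubeDomain T ε O :=
  fun _ hx => ⟨hB hx.1, hx.2⟩

theorem IsNormalFrame.measurableSet_tubeDomain (hT : IsNormalFrame c O T) (hB : B ⊆ O)
    (hBm : MeasurableSet B) : MeasurableSet (tubeDomain T ε B) := by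
  have h2 : ContinuousOn (fun x : E n × E k => ‖T x.1 x.2‖) (O ×ˢ Set.univ) :=
    ((hT.contDiffOn.continuousOn.comp continuous_fst.continuousOn fun x hx => hx.1).clm_apply
      continuous_snd.continuousOn).norm
  have h3 := (h2.isOpen_inter_preimage hT.isOpen_prod (isOpen_Iio (a := ε))).measurableSet
  convert! (measurable_fst hBm : MeasurableSet (Prod.fst ⁻¹' B : Set (E n × E k))).inter h3 using 1
  ext x
  exact ⟨fun hx => ⟨hx.1, ⟨hB hx.1, trivial⟩, hx.2⟩, fun hx => ⟨hx.1, hx.2.2⟩⟩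

theorem IsNormalFrame.measurableSet_tubeOver (hT : IsNormalFrame c O T) (hc : IsC4Chart c)
    (hε : IsTubularRadius n M ε) (hB : B ⊆ O) (hBm : MeasurableSet B) :
    MeasurableSet (tubeOver n M ε ((fun u => (c u : E (n + k))) '' B)) := by
  rw [hT.tubeOver_image hB]
  exact (hT.measurableSet_tubeDomain hB hBm).image_of_continuousOn_injOn
    ((hT.contDiffOn_tubeMap hc).continuousOn.mono fun x hx => ⟨hB hx.1, trivial⟩)
    ((hT.injOn_tubeMap hε).mono (tubeDomain_mono hB))

theorem IsNormalFrame.setIntegral_tubeOver (hT : IsNormalFrame c O T) (hc : IsC4Chart c)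
    (hε : IsTubularRadius n M ε) (hB : B ⊆ O) (hBm : MeasurableSet B) (g : E (n + k) → ℝ) :
    ∫ y in tubeOver n M ε ((fun u => (c u : E (n + k))) '' B), g y =
      ∫ x in tubeDomain T ε B, tubeJacobian c T x * g (tubeMap c T x) := by
  rw [hT.tubeOver_image hB]
  exact setIntegral_image_prod (hT.measurableSet_tubeDomain hB hBm)
    (fun x hx => (hT.hasFDerivAt_tubeMap hc (hB hx.1)).hasFDerivWithinAt)
    ((hT.injOn_tubeMap hε).mono (tubeDomain_mono hB)) g

/-- Dilation of the second factor of `ℝ^n × ℝ^k` in an integral. -/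
theorem setIntegral_prod_smul {r : ℝ} (hr : 0 < r) (s : Set (E n × E k)) (F : E n × E k → ℝ) :
    (r ^ k)⁻¹ * ∫ x in s, F x =
      ∫ x in {x : E n × E k | (x.1, r • x.2) ∈ s}, F (x.1, r • x.2) := by
  set D : E n × E k → E n × E k := Prod.map id (r • ·) with hD
  have hmap : Measure.map D volume = ENNReal.ofReal (r ^ k)⁻¹ • (volume : Measure (E n × E k)) := by
    rw [Measure.volume_eq_prod, hD, ← Measure.map_prod_map _ _ measurable_id
      (measurable_const_smul r), Measure.map_id, Measure.map_addHaar_smul _ hr.ne',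
      finrank_euclideanSpace, Fintype.card_fin, abs_of_pos (by positivity), Measure.prod_smul_right]
  have hemb : MeasurableEmbedding D :=
    ((Homeomorph.refl (E n)).prodCongr (Homeomorph.smulOfNeZero r hr.ne')).measurableEmbedding
  have := hemb.setIntegral_map (μ := volume) F s
  rw [hmap, Measure.restrict_smul, integral_smul_measure, ENNReal.toReal_ofReal (by positivity),
    smul_eq_mul] at this
  exact this

end

section

/-! ### The Laplace asymptotics over a piece of a chart -/

/-- The functions `f₀` to which the Laplace method is applied: `C^2` on the tube, constant on `M`
with critical points there, and uniformly convex in the normal directions. -/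
structure IsLaplacePotential {d : ℕ} (n : ℕ) (M : Set (E d)) (ε : ℝ) (f₀ : E d → ℝ) (m κ : ℝ) :
    Prop where
  contDiffOn : ContDiffOn ℝ 2 f₀ (tube M ε)
  eq_of_mem : ∀ p ∈ M, f₀ p = m
  fderiv_eq_zero : ∀ p ∈ M, fderiv ℝ f₀ p = 0
  pos : 0 < κ
  le_hessian : ∀ p ∈ M, ∀ v ∈ normalSpace n M p, ‖v‖ < ε → ∀ w ∈ normalSpace n M p,
    κ * ‖w‖ ^ 2 ≤ fderiv ℝ (fderiv ℝ f₀) (p + v) w w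

section
variable {d n : ℕ} {M : Set (E d)} {ε m κ : ℝ} {f₀ : E d → ℝ}

theorem IsLaplacePotential.contDiffAt (hf : IsLaplacePotential n M ε f₀ m κ) {x : E d}
    (hx : x ∈ tube M ε) : ContDiffAt ℝ 2 f₀ x :=
  hf.contDiffOn.contDiffAt (Metric.isOpen_thickening.mem_nhds hx)

theorem IsLaplacePotential.mul_norm_sq_le (hf : IsLaplacePotential n M ε f₀ m κ) {p v : E d}
    (hp : p ∈ M) (hv : v ∈ normalSpace n M p) (hvε : ‖v‖ < ε) :
    κ * ‖v‖ ^ 2 / 2 ≤ f₀ (p + v) - m := by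
  have hs : ∀ s ∈ Set.Icc (0 : ℝ) 1, ‖s • v‖ < ε := fun s hs => by
    rw [norm_smul, Real.norm_of_nonneg hs.1]
    exact (mul_le_of_le_one_left (norm_nonneg v) hs.2).trans_lt hvε
  rw [← hf.eq_of_mem p hp]
  exact half_le_sub_of_le_fderiv_fderiv Metric.isOpen_thickening hf.contDiffOn
    (fun s h => add_mem_tube hp (hs s h)) (by rw [hf.fderiv_eq_zero p hp]; rfl)
    fun s h => hf.le_hessian p hp _ (Submodule.smul_mem _ _ hv) (hs s h) v hv

theorem IsLaplacePotential.continuousOn_fderiv_fderiv (hf : IsLaplacePotential n M ε f₀ m κ) :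
    ContinuousOn (fderiv ℝ (fderiv ℝ f₀)) (tube M ε) :=
  (hf.contDiffOn.fderiv_of_isOpen (m := 1) Metric.isOpen_thickening
    (by norm_num)).continuousOn_fderiv_of_isOpen Metric.isOpen_thickening (by norm_num)

end

/-- The total mass of the unnormalised standard Gaussian of `ℝ^k`. -/
def gaussMass (k : ℕ) : ℝ := ∫ s : E k, Real.exp (-(‖s‖ ^ 2 / 2))

theorem integrable_exp_neg_mul_norm_sq {k : ℕ} {b : ℝ} (hb : 0 < b) :
    Integrable fun s : E k => Real.exp (-(b * ‖s‖ ^ 2)) := by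
  have h := (GaussianFourier.integrable_cexp_neg_mul_sq_norm_add (V := E k) (b := (b : ℂ))
    (by simpa using hb) 0 0).norm
  refine h.congr (Eventually.of_forall fun s => ?_)
  simp only [Complex.norm_exp]
  congr 1
  simp [← Complex.ofReal_pow, ← Complex.ofReal_mul]

theorem gaussMass_pos (k : ℕ) : 0 < gaussMass k := by
  refine integral_exp_pos ((integrable_exp_neg_mul_norm_sq (k := k) (b := 1 / 2)
    (by norm_num)).congr (Eventually.of_forall fun s => ?_))
  simp only
  congr 1
  ring

variable {n k : ℕ} {M : Set (E (n + k))} {c : OpenPartialHomeomorph (E n) M} {ε m κ : ℝ}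
  {O B : Set (E n)} {T : E n → E k →L[ℝ] E (n + k)} {f₀ : E (n + k) → ℝ}

/-- The Hessian of `f` at `c u`, read in the normal frame `T`. -/
def frameHessian (f : E (n + k) → ℝ) (c : OpenPartialHomeomorph (E n) M)
    (T : E n → E k →L[ℝ] E (n + k)) (u : E n) : E k →L[ℝ] E k →L[ℝ] ℝ :=
  (fderiv ℝ (fderiv ℝ f) (c u : E (n + k))).bilinearComp (T u) (T u)

theorem IsLaplacePotential.frameHessian_symm (hf : IsLaplacePotential n M ε f₀ m κ) (hε : 0 < ε)
    (u : E n) (s t : E k) : frameHessian f₀ c T u s t = frameHessian f₀ c T u t s :=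
  ((hf.contDiffAt (Metric.self_subset_thickening hε M (c u).2)).isSymmSndFDerivAt (by simp)).eq _ _

theorem IsLaplacePotential.le_frameHessian (hf : IsLaplacePotential n M ε f₀ m κ) (hε : 0 < ε)
    (hT : IsNormalFrame c O T) {u : E n} (hu : u ∈ O) (s : E k) :
    κ * ‖s‖ ^ 2 ≤ frameHessian f₀ c T u s s := by
  have h := hf.le_hessian (c u) (c u).2 0 (Submodule.zero_mem _) (by simpa using hε) _
    (hT.mem_normalSpace u hu s)
  rw [add_zero] at h
  refine le_trans ?_ h
  have := hf.pos
  gcongr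
  exact hT.norm_le u hu s

theorem IsLaplacePotential.frameHessian_pos (hf : IsLaplacePotential n M ε f₀ m κ) (hε : 0 < ε)
    (hT : IsNormalFrame c O T) {u : E n} (hu : u ∈ O) (s : E k) (hs : s ≠ 0) :
    0 < frameHessian f₀ c T u s s :=
  lt_of_lt_of_le (mul_pos hf.pos (pow_pos (norm_pos_iff.2 hs) 2)) (hf.le_frameHessian hε hT hu s)

theorem IsNormalFrame.det_gram_pos (hT : IsNormalFrame c O T) {u : E n} (hu : u ∈ O) :
    0 < (Matrix.gram ℝ fun i => T u (EuclideanSpace.single i 1)).det := by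
  refine (Matrix.posDef_gram_of_linearIndependent ?_).det_pos
  have hker : (T u).toLinearMap.ker = ⊥ := by
    refine LinearMap.ker_eq_bot'.2 fun t ht => ?_
    have h := hT.norm_le u hu t
    have ht' : T u t = 0 := ht
    rw [ht', norm_zero] at h
    exact norm_le_zero_iff.1 h
  have h := (EuclideanSpace.basisFun (Fin k) ℝ).toBasis.linearIndependent.map' _ hker
  convert! h using 1
  ext i : 1
  simp

theorem IsC4Chart.det_metricTensor_pos (hc : IsC4Chart c) {u : E n} (hu : u ∈ c.source) :
    0 < (metricTensor c u).det := by
  refine (Matrix.posDef_gram_of_linearIndependent ?_).det_pos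
  have h := (EuclideanSpace.basisFun (Fin n) ℝ).toBasis.linearIndependent.map'
    (fderiv ℝ (fun u => (c u : E (n + k))) u).toLinearMap (LinearMap.ker_eq_bot.2 (hc.2 u hu))
  convert! h using 1
  ext i : 1
  simp

theorem IsLaplacePotential.det_frameHessian (hf : IsLaplacePotential n M ε f₀ m κ) (hε : 0 < ε)
    (hc : IsC4Chart c) (hT : IsNormalFrame c O T) {u : E n} (hu : u ∈ O) :
    (Matrix.of fun i j =>
      frameHessian f₀ c T u (EuclideanSpace.single i 1) (EuclideanSpace.single j 1)).det =
    normalHessianDet n M f₀ (c u) *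
      (Matrix.gram ℝ fun i => T u (EuclideanSpace.single i 1)).det :=
  det_fderiv_fderiv_eq hε hf.contDiffOn hc (hT.subset_source hu) (T u) (hT.mem_normalSpace u hu)

/-- In a frame, the normal Hessian and the Gram matrix are both positive definite. -/
theorem IsLaplacePotential.normalHessianDet_pos_of_frame (hf : IsLaplacePotential n M ε f₀ m κ)
    (hε : 0 < ε) (hc : IsC4Chart c) (hT : IsNormalFrame c O T) {u : E n} (hu : u ∈ O) :
    0 < normalHessianDet n M f₀ (c u) := by
  have h := (posDef_matrixOf_bilin (hf.frameHessian_symm (c := c) (T := T) hε u)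
    (hf.frameHessian_pos hε hT hu)).det_pos
  rw [hf.det_frameHessian hε hc hT hu] at h
  exact pos_of_mul_pos_left h (hT.det_gram_pos hu).le

/-- The factor `√det (gram (T u))` of the Jacobian cancels the one in the Gaussian integral. -/
theorem IsLaplacePotential.tubeJacobian_mul_integral (hf : IsLaplacePotential n M ε f₀ m κ)
    (hε : 0 < ε) (hc : IsC4Chart c) (hT : IsNormalFrame c O T) {u : E n} (hu : u ∈ O) :
    tubeJacobian c T (u, 0) * ∫ s, Real.exp (-(frameHessian f₀ c T u s s / 2)) =
      gaussMass k * (|normalHessianDet n M f₀ (c u)| ^ (-(1 / 2) : ℝ) *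
        √(metricTensor c u).det) := by
  have hG := hT.det_gram_pos hu
  have hH := hf.normalHessianDet_pos_of_frame hε hc hT hu
  rw [hT.tubeJacobian_zero hc hu, integral_exp_neg_bilin_div_two
    (hf.frameHessian_symm (c := c) (T := T) hε u) (hf.frameHessian_pos hε hT hu),
    hf.det_frameHessian hε hc hT hu, abs_of_pos hH, Real.rpow_neg hH.le, ← Real.sqrt_eq_rpow,
    Real.sqrt_mul hH.le, ← gaussMass]
  have h1 := (Real.sqrt_pos.2 hG).ne'
  have h2 := (Real.sqrt_pos.2 hH).ne'
  field_simp

theorem tendsto_sqrt_nhdsGT_zero : Tendsto (fun θ : ℝ => √θ) (𝓝[>] 0) (𝓝 0) := by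
  simpa using (Real.continuous_sqrt.tendsto 0).mono_left (nhdsWithin_le_nhds (s := Set.Ioi 0))

/-- The integrand of the Laplace integral in tubular coordinates, before the dilation of the
normal variable. -/
def laplaceIntegrand (f₀ : E (n + k) → ℝ) (m : ℝ) (c : OpenPartialHomeomorph (E n) M)
    (T : E n → E k →L[ℝ] E (n + k)) (g : E (n + k) → ℝ) (θ : ℝ) (x : E n × E k) : ℝ :=
  tubeJacobian c T x * (g (tubeMap c T x) * Real.exp (-((f₀ (tubeMap c T x) - m) / θ)))

theorem IsLaplacePotential.continuousOn_laplaceIntegrand (hf : IsLaplacePotential n M ε f₀ m κ)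
    (hc : IsC4Chart c) (hT : IsNormalFrame c O T) {g : E (n + k) → ℝ}
    (hg : ContinuousOn g (tube M ε)) (θ : ℝ) :
    ContinuousOn (laplaceIntegrand f₀ m c T g θ) (tubeDomain T ε O) := by
  have hsub : tubeDomain T ε O ⊆ O ×ˢ Set.univ := fun x hx => ⟨hx.1, trivial⟩
  have hΦ := (hT.contDiffOn_tubeMap hc).continuousOn.mono hsub
  have hmaps : Set.MapsTo (tubeMap c T) (tubeDomain T ε O) (tube M ε) :=
    fun x hx => tubeMap_mem_tube hx
  have h1 := hf.contDiffOn.continuousOn.comp hΦ hmaps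
  exact ((hT.continuousOn_tubeJacobian hc).mono hsub).mul ((hg.comp hΦ hmaps).mul
    (Real.continuous_exp.comp_continuousOn ((h1.sub continuousOn_const).div_const θ).neg))

theorem IsLaplacePotential.tendsto_laplaceIntegrand (hf : IsLaplacePotential n M ε f₀ m κ)
    (hε : 0 < ε) (hc : IsC4Chart c) (hT : IsNormalFrame c O T) {g : ℝ → E (n + k) → ℝ}
    {g₀ : E (n + k) → ℝ} (hg : TendstoUniformlyOn g g₀ (𝓝[>] 0) (tube M ε))
    (hg₀ : ContinuousOn g₀ (tube M ε)) {u : E n} (hu : u ∈ O) (s : E k) :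
    (∀ᶠ θ in 𝓝[>] 0, ‖T u (√θ • s)‖ < ε) ∧
    Tendsto (fun θ => laplaceIntegrand f₀ m c T (g θ) θ (u, √θ • s)) (𝓝[>] 0)
      (𝓝 (tubeJacobian c T (u, 0) *
        (g₀ (c u) * Real.exp (-(frameHessian f₀ c T u s s / 2))))) := by
  have hs : Tendsto (fun θ : ℝ => √θ • s) (𝓝[>] 0) (𝓝 0) := by
    simpa using tendsto_sqrt_nhdsGT_zero.smul_const s
  have hTs : Tendsto (fun θ : ℝ => T u (√θ • s)) (𝓝[>] 0) (𝓝 0) := by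
    have h := ((T u).continuous.tendsto 0).comp hs
    rwa [map_zero] at h
  have hev : ∀ᶠ θ in 𝓝[>] (0 : ℝ), ‖T u (√θ • s)‖ < ε := by
    have := hTs.norm.eventually (gt_mem_nhds (by simpa using hε))
    simpa using this
  refine ⟨hev, ?_⟩
  have hJ : Tendsto (fun θ : ℝ => tubeJacobian c T (u, √θ • s)) (𝓝[>] 0)
      (𝓝 (tubeJacobian c T (u, 0))) :=
    ((hT.continuousOn_tubeJacobian hc).continuousAt
      (hT.isOpen_prod.mem_nhds ⟨hu, trivial⟩)).tendsto.comp (tendsto_const_nhds.prodMk_nhds hs)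
  have hpM : (c u : E (n + k)) ∈ M := (c u).2
  have hpt : (c u : E (n + k)) ∈ tube M ε := Metric.self_subset_thickening hε M hpM
  have hΦ : Tendsto (fun θ : ℝ => tubeMap c T (u, √θ • s)) (𝓝[>] 0)
      (𝓝[tube M ε] (c u : E (n + k))) := by
    refine tendsto_nhdsWithin_iff.2 ⟨?_, hev.mono fun θ h => tubeMap_mem_tube ⟨hu, h⟩⟩
    simpa [tubeMap] using hTs.const_add (c u : E (n + k))
  have hgl := hg.tendsto_comp (hg₀ _ hpt) hΦ
  have hexp := tendsto_div_of_fderiv_eq_zero (v := T u s) (hf.contDiffAt hpt)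
    (by rw [hf.fderiv_eq_zero _ hpM]; rfl)
  refine hJ.mul (hgl.mul ((Real.continuous_exp.tendsto _).comp (hexp.neg.congr fun θ => ?_)))
  rw [tubeMap, map_smul, hf.eq_of_mem _ hpM]

/-- Laplace asymptotics for the part of the tube over a piece `c '' B` of a chart. In tubular
coordinates with the normal variable dilated by `√θ`, this is dominated convergence: the exponent
tends to the quadratic form of the normal Hessian, and is bounded by a fixed Gaussian. -/
theorem IsLaplacePotential.tendsto_setIntegral_tubeOver (hf : IsLaplacePotential n M ε f₀ m κ)
    (hε : IsTubularRadius n M ε) (hc : IsC4Chart c) (hT : IsNormalFrame c O T) {K : Set (E n)}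
    (hK : IsCompact K) (hKO : K ⊆ O) (hBK : B ⊆ K) (hB : MeasurableSet B)
    {g : ℝ → E (n + k) → ℝ} {g₀ : E (n + k) → ℝ}
    (hgc : ∀ᶠ θ in 𝓝[>] 0, ContinuousOn (g θ) (tube M ε))
    (hg : TendstoUniformlyOn g g₀ (𝓝[>] 0) (tube M ε))
    (hg₀ : ContinuousOn g₀ (tube M ε)) {C : ℝ} (hC : ∀ x ∈ tube M ε, |g₀ x| ≤ C) :
    Tendsto (fun θ => (√θ ^ k)⁻¹ * ∫ y in tubeOver n M ε ((fun u => (c u : E (n + k))) '' B),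
        g θ y * Real.exp (-((f₀ y - m) / θ))) (𝓝[>] 0)
      (𝓝 (gaussMass k * ∫ u in B, g₀ (c u) * |normalHessianDet n M f₀ (c u)| ^ (-(1 / 2) : ℝ) *
        √(metricTensor c u).det)) := by
  have hε0 := hε.1
  have hBO := hBK.trans hKO
  obtain ⟨CJ, hCJ⟩ := (hK.prod (isCompact_closedBall (0 : E k) ε)).exists_bound_of_continuousOn
    ((hT.continuousOn_tubeJacobian hc).mono (Set.prod_mono hKO (Set.subset_univ _)))
  have hBvol : volume B ≠ ⊤ := ((measure_mono hBK).trans_lt hK.measure_lt_top).ne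
  set S : ℝ → Set (E n × E k) := fun θ => {x | (x.1, √θ • x.2) ∈ tubeDomain T ε B} with hS
  set H : ℝ → E n × E k → ℝ := fun θ =>
    (S θ).indicator fun x => laplaceIntegrand f₀ m c T (g θ) θ (x.1, √θ • x.2) with hH
  set H₀ : E n × E k → ℝ := (B ×ˢ Set.univ).indicator fun x =>
    tubeJacobian c T (x.1, 0) *
      (g₀ (c x.1) * Real.exp (-(frameHessian f₀ c T x.1 x.2 x.2 / 2))) with hH₀
  -- `C + 1` bounds `g θ` once it is within `1` of `g₀`; the Gaussian bound uses `‖t‖ ≤ ‖T u t‖`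
  set bd : E n × E k → ℝ := fun x =>
    B.indicator (fun _ => CJ * (C + 1)) x.1 * Real.exp (-(κ / 2 * ‖x.2‖ ^ 2)) with hbd
  have hscale : ∀ θ : ℝ, Continuous fun x : E n × E k => (x.1, √θ • x.2) := fun θ => by fun_prop
  have hSm : ∀ θ, MeasurableSet (S θ) := fun θ =>
    (hscale θ).measurable (hT.measurableSet_tubeDomain hBO hB)
  have hbdi : Integrable bd := by
    rw [hbd, Measure.volume_eq_prod]
    exact ((integrable_indicator_iff hB).2 (integrableOn_const hBvol)).mul_prod
      (integrable_exp_neg_mul_norm_sq (half_pos hf.pos))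
  have hlimpt : ∀ x, Tendsto (fun θ => H θ x) (𝓝[>] 0) (𝓝 (H₀ x)) := by
    rintro ⟨u, s⟩
    by_cases hu : u ∈ B
    · obtain ⟨h1, h2⟩ := hf.tendsto_laplaceIntegrand hε0 hc hT hg hg₀ (hBO hu) s
      have h3 : H₀ (u, s) = tubeJacobian c T (u, 0) *
          (g₀ (c u) * Real.exp (-(frameHessian f₀ c T u s s / 2))) := by
        rw [hH₀, Set.indicator_of_mem (show (u, s) ∈ B ×ˢ Set.univ from ⟨hu, trivial⟩)]
      rw [h3]
      refine h2.congr' (h1.mono fun θ h => ?_)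
      simp only [hH]
      rw [Set.indicator_of_mem (show (u, s) ∈ S θ from ⟨hu, h⟩)]
    · have h3 : H₀ (u, s) = 0 := by
        rw [hH₀, Set.indicator_of_notMem (show (u, s) ∉ B ×ˢ Set.univ from fun h => hu h.1)]
      rw [h3]
      have h4 : ∀ θ, H θ (u, s) = 0 := fun θ =>
        Set.indicator_of_notMem (show (u, s) ∉ S θ from fun h => hu h.1) _
      simp_rw [h4]
      exact tendsto_const_nhds
  have hCJ0 : ∀ u ∈ B, 0 ≤ CJ := fun u hu => (norm_nonneg _).trans
    (hCJ (u, 0) ⟨hBK hu, Metric.mem_closedBall_self hε0.le⟩)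
  have hgbd : ∀ᶠ θ in 𝓝[>] (0 : ℝ), ∀ y ∈ tube M ε, |g θ y| ≤ C + 1 := by
    filter_upwards [Metric.tendstoUniformlyOn_iff.1 hg 1 one_pos] with θ h y hy
    have h1 := h y hy
    rw [dist_comm, Real.dist_eq] at h1
    calc |g θ y| = |(g θ y - g₀ y) + g₀ y| := by rw [sub_add_cancel]
      _ ≤ |g θ y - g₀ y| + |g₀ y| := abs_add_le _ _
      _ ≤ C + 1 := by linarith [hC y hy]
  have hHbd : ∀ᶠ θ in 𝓝[>] (0 : ℝ), ∀ x, ‖H θ x‖ ≤ bd x := by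
    filter_upwards [hgbd, self_mem_nhdsWithin] with θ hθ hpos
    rintro ⟨u, s⟩
    by_cases hx : (u, s) ∈ S θ
    · have hu : u ∈ B := hx.1
      have hv : ‖T u (√θ • s)‖ < ε := hx.2
      have hsn : ‖√θ • s‖ ≤ ‖T u (√θ • s)‖ := hT.norm_le u (hBO hu) _
      have hJ : ‖tubeJacobian c T (u, √θ • s)‖ ≤ CJ :=
        hCJ _ ⟨hBK hu, by simpa using hsn.trans hv.le⟩
      have hlow := hf.mul_norm_sq_le (c u).2 (hT.mem_normalSpace u (hBO hu) (√θ • s)) hv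
      have hsq : ‖√θ • s‖ ^ 2 = θ * ‖s‖ ^ 2 := by
        rw [norm_smul, mul_pow, Real.norm_eq_abs, sq_abs, Real.sq_sqrt (le_of_lt hpos)]
      have hE : Real.exp (-((f₀ (tubeMap c T (u, √θ • s)) - m) / θ)) ≤
          Real.exp (-(κ / 2 * ‖s‖ ^ 2)) := by
        rw [Real.exp_le_exp, neg_le_neg_iff, le_div_iff₀ hpos]
        refine le_trans ?_ hlow
        have := mul_le_mul_of_nonneg_left (pow_le_pow_left₀ (norm_nonneg _) hsn 2) hf.pos.le
        rw [hsq] at this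
        linarith
      simp only [hH, hbd, Set.indicator_of_mem hx, Set.indicator_of_mem hu, laplaceIntegrand]
      rw [norm_mul, norm_mul, Real.norm_of_nonneg (Real.exp_pos _).le, ← mul_assoc]
      have hg1 : ‖g θ (tubeMap c T (u, √θ • s))‖ ≤ C + 1 :=
        hθ _ (tubeMap_mem_tube ⟨hBO hu, hv⟩)
      exact mul_le_mul (mul_le_mul hJ hg1 (norm_nonneg _) (hCJ0 u hu)) hE (Real.exp_pos _).le
        (mul_nonneg (hCJ0 u hu) ((norm_nonneg _).trans hg1))
    · rw [hH]
      simp only [Set.indicator_of_notMem hx, norm_zero, hbd]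
      by_cases hu : u ∈ B
      · have hC0 : 0 ≤ C + 1 := (abs_nonneg _).trans
          (hθ (c u) (Metric.self_subset_thickening hε0 M (c u).2))
        rw [Set.indicator_of_mem hu]
        exact mul_nonneg (mul_nonneg (hCJ0 u hu) hC0) (Real.exp_pos _).le
      · rw [Set.indicator_of_notMem hu, zero_mul]
  have hHm : ∀ᶠ θ in 𝓝[>] (0 : ℝ), AEStronglyMeasurable (H θ) := by
    filter_upwards [hgc] with θ hθ
    refine (aestronglyMeasurable_indicator_iff (hSm θ)).2 ?_
    refine ContinuousOn.aestronglyMeasurable ?_ (hSm θ)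
    exact (hf.continuousOn_laplaceIntegrand hc hT hθ θ).comp (hscale θ).continuousOn
      fun x hx => tubeDomain_mono hBO hx
  -- measurability along the filter is only eventual, so the limit is taken along a sequence
  have hH₀m : AEStronglyMeasurable H₀ := by
    obtain ⟨θs, hθs⟩ := (𝓝[>] (0 : ℝ)).exists_seq_tendsto
    obtain ⟨N, hN⟩ := eventually_atTop.1 (hθs.eventually hHm)
    refine aestronglyMeasurable_of_tendsto_ae atTop (f := fun i => H (θs (i + N)))
      (fun i => hN _ (Nat.le_add_left N i)) (ae_of_all _ fun x => ?_)
    exact ((hlimpt x).comp hθs).comp (tendsto_add_atTop_nat N)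
  have hH₀i : Integrable H₀ := by
    refine hbdi.mono' hH₀m (ae_of_all _ fun x => ?_)
    exact le_of_tendsto (hlimpt x).norm (hHbd.mono fun θ h => h x)
  have hmain : Tendsto (fun θ => ∫ x, H θ x) (𝓝[>] 0) (𝓝 (∫ x, H₀ x)) :=
    tendsto_integral_filter_of_dominated_convergence bd hHm
      (hHbd.mono fun θ h => ae_of_all _ h) hbdi (ae_of_all _ hlimpt)
  have hval : ∫ x, H₀ x = gaussMass k * ∫ u in B, g₀ (c u) *
      |normalHessianDet n M f₀ (c u)| ^ (-(1 / 2) : ℝ) * √(metricTensor c u).det := by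
    rw [Measure.volume_eq_prod, integral_prod _ (by rwa [← Measure.volume_eq_prod]),
      ← integral_const_mul, ← integral_indicator hB]
    congr 1 with u
    by_cases hu : u ∈ B
    · have h1 : ∀ s, H₀ (u, s) = g₀ (c u) * (tubeJacobian c T (u, 0) *
          Real.exp (-(frameHessian f₀ c T u s s / 2))) := fun s => by
        rw [hH₀, Set.indicator_of_mem (show (u, s) ∈ B ×ˢ Set.univ from ⟨hu, trivial⟩)]
        ring
      simp_rw [h1, Set.indicator_of_mem hu]
      rw [integral_const_mul, integral_const_mul,
        hf.tubeJacobian_mul_integral hε0 hc hT (hBO hu)]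
      ring
    · have h1 : ∀ s, H₀ (u, s) = 0 := fun s => by
        rw [hH₀, Set.indicator_of_notMem (show (u, s) ∉ B ×ˢ Set.univ from fun h => hu h.1)]
      simp [h1, hu]
  rw [hval] at hmain
  refine hmain.congr' ?_
  filter_upwards [self_mem_nhdsWithin] with θ hθ
  rw [hT.setIntegral_tubeOver hc hε hBO hB, setIntegral_prod_smul (Real.sqrt_pos.2 hθ),
    ← integral_indicator (hSm θ)]
  rfl

end

section

/-! ### The Riemannian volume on the patches -/

/-- The patch of `M` parametrised by a chart, as a subset of the ambient space. -/
def patch {d n : ℕ} {M : Set (E d)} (c : OpenPartialHomeomorph (E n) M) : Set (E d) :=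
  (fun u => (c u : E d)) '' c.source

section
variable {d n : ℕ} {M : Set (E d)} {c : OpenPartialHomeomorph (E n) M} {B : Set (E n)}

theorem IsC4Chart.continuousOn (hc : IsC4Chart c) :
    ContinuousOn (fun u => (c u : E d)) c.source := hc.1.continuousOn

theorem injOn_chart : Set.InjOn (fun u => (c u : E d)) c.source :=
  fun _ hx _ hy hxy => c.injOn hx hy (Subtype.ext hxy)

theorem IsC4Chart.measurableSet_image (hc : IsC4Chart c) (hB : B ⊆ c.source)
    (hBm : MeasurableSet B) : MeasurableSet ((fun u => (c u : E d)) '' B) :=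
  hBm.image_of_continuousOn_injOn (hc.continuousOn.mono hB) (injOn_chart.mono hB)

theorem IsC4Chart.measurableSet_patch (hc : IsC4Chart c) : MeasurableSet (patch c) :=
  hc.measurableSet_image subset_rfl c.open_source.measurableSet

theorem patch_subset : patch c ⊆ M := by
  rintro _ ⟨u, -, rfl⟩
  exact (c u).2

theorem IsC4Chart.measurableSet_source_inter_preimage (hc : IsC4Chart c) {S : Set (E d)}
    (hS : MeasurableSet S) : MeasurableSet (c.source ∩ (fun u => (c u : E d)) ⁻¹' S) := by
  have h := (hc.continuousOn.domRestrict.measurable hS)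
  have h2 := c.open_source.measurableSet.subtype_image h
  convert! h2 using 1
  ext u
  simp [and_comm]

theorem IsC4Chart.continuousOn_det_metricTensor (hc : IsC4Chart c) :
    ContinuousOn (fun u => (metricTensor c u).det) c.source := by
  have h : ContinuousOn (fderiv ℝ (fun u => (c u : E d))) c.source :=
    hc.1.continuousOn_fderiv_of_isOpen c.open_source (by norm_num)
  have h1 : ContinuousOn (fun u => metricTensor c u) c.source := by
    refine continuousOn_pi.2 fun i => continuousOn_pi.2 fun j => ?_
    exact ContinuousOn.inner (𝕜 := ℝ) (h.clm_apply continuousOn_const)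
      (h.clm_apply continuousOn_const)
  exact (continuous_id.matrix_det).comp_continuousOn h1

theorem IsC4Chart.aemeasurable_density (hc : IsC4Chart c) (hB : B ⊆ c.source)
    (hBm : MeasurableSet B) :
    AEMeasurable (fun u => ENNReal.ofReal √(metricTensor c u).det) (volume.restrict B) :=
  ((hc.continuousOn_det_metricTensor.mono hB).sqrt.aemeasurable hBm).ennreal_ofReal

theorem IsC4Chart.aemeasurable_chart (hc : IsC4Chart c) (hB : B ⊆ c.source)
    (hBm : MeasurableSet B) : AEMeasurable (fun u => (c u : E d))
      ((volume.restrict B).withDensity fun u => ENNReal.ofReal √(metricTensor c u).det) :=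
  ((hc.continuousOn.mono hB).aemeasurable hBm).mono_ac (withDensity_absolutelyContinuous _ _)

theorem IsC4Chart.chartVolume_restrict_image (hc : IsC4Chart c) (hB : B ⊆ c.source)
    (hBm : MeasurableSet B) :
    (chartVolume c).restrict ((fun u => (c u : E d)) '' B) =
      Measure.map (fun u => (c u : E d))
        ((volume.restrict B).withDensity fun u => ENNReal.ofReal √(metricTensor c u).det) := by
  rw [chartVolume, Measure.restrict_map_of_aemeasurable
    (hc.aemeasurable_chart subset_rfl c.open_source.measurableSet) (hc.measurableSet_image hB hBm),
    restrict_withDensity', Measure.restrict_restrict' c.open_source.measurableSet]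
  congr 3
  ext u
  exact ⟨fun ⟨⟨v, hv, hvu⟩, hu⟩ => injOn_chart (hB hv) hu hvu ▸ hv,
    fun hu => ⟨⟨u, hu, rfl⟩, hB hu⟩⟩

theorem IsC4Chart.chartVolume_compl_patch (hc : IsC4Chart c) : chartVolume c (patch c)ᶜ = 0 := by
  rw [chartVolume, Measure.map_apply_of_aemeasurable
    (hc.aemeasurable_chart subset_rfl c.open_source.measurableSet) hc.measurableSet_patch.compl]
  refine withDensity_absolutelyContinuous _ _ ?_
  rw [Measure.restrict_apply' c.open_source.measurableSet]
  convert! measure_empty (μ := (volume : Measure (E n)))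
  ext u
  simp only [Set.mem_inter_iff, Set.mem_preimage, Set.mem_compl_iff, Set.mem_empty_iff_false,
    iff_false, not_and]
  exact fun h hu => h ⟨u, hu, rfl⟩

theorem IsC4Chart.chartVolume_inter_patch (hc : IsC4Chart c) (S : Set (E d)) :
    chartVolume c (S ∩ patch c) = chartVolume c S := by
  refine le_antisymm (measure_mono Set.inter_subset_left) ?_
  refine (measure_le_inter_add_sdiff _ S (patch c)).trans ?_
  have h : chartVolume c (S \ patch c) = 0 :=
    measure_mono_null (fun x hx => hx.2) hc.chartVolume_compl_patch
  rw [h, add_zero]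

theorem IsC4Chart.chartVolume_image_lt_top (hc : IsC4Chart c) {K : Set (E n)} (hK : IsCompact K)
    (hKs : K ⊆ c.source) : chartVolume c ((fun u => (c u : E d)) '' K) < ⊤ := by
  rw [← Measure.restrict_apply_univ,
    hc.chartVolume_restrict_image hKs hK.measurableSet,
    Measure.map_apply_of_aemeasurable (hc.aemeasurable_chart hKs hK.measurableSet)
      MeasurableSet.univ, Set.preimage_univ, withDensity_apply _ MeasurableSet.univ,
    Measure.restrict_univ]
  obtain ⟨C, hC⟩ := hK.exists_bound_of_continuousOn (hc.continuousOn_det_metricTensor.mono hKs).sqrt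
  refine (setLIntegral_mono' (g := fun _ => ENNReal.ofReal C) hK.measurableSet fun u hu =>
    ENNReal.ofReal_le_ofReal ((le_abs_self _).trans (hC u hu))).trans_lt ?_
  rw [setLIntegral_const]
  exact ENNReal.mul_lt_top ENNReal.ofReal_lt_top hK.measure_lt_top

theorem IsC4Chart.setIntegral_chartVolume (hc : IsC4Chart c) (hMm : MeasurableSet M)
    (hB : B ⊆ c.source) (hBm : MeasurableSet B) {F : E d → ℝ} (hF : ContinuousOn F M) :
    ∫ p in (fun u => (c u : E d)) '' B, F p ∂chartVolume c =
      ∫ u in B, F (c u) * √(metricTensor c u).det := by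
  have hFm : AEStronglyMeasurable F ((chartVolume c).restrict ((fun u => (c u : E d)) '' B)) :=
    (hF.aestronglyMeasurable hMm).mono_measure (Measure.restrict_mono_set _ (by
      rintro _ ⟨u, -, rfl⟩; exact (c u).2))
  rw [hc.chartVolume_restrict_image hB hBm] at hFm ⊢
  rw [integral_map (hc.aemeasurable_chart hB hBm) hFm,
    integral_withDensity_eq_integral_toReal_smul₀ (hc.aemeasurable_density hB hBm)
      (ae_of_all _ fun _ => ENNReal.ofReal_lt_top)]
  congr 1 with u
  rw [ENNReal.toReal_ofReal (Real.sqrt_nonneg _), smul_eq_mul, mul_comm]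

end

variable {n k : ℕ} {M : Set (E (n + k))} {c c' : OpenPartialHomeomorph (E n) M} {ε m κ : ℝ}
  {f₀ : E (n + k) → ℝ}

/-- A small parameter domain: an open set with compact closure in the domain of a normal frame. -/
def IsSmall (c : OpenPartialHomeomorph (E n) M) (V : Set (E n)) : Prop :=
  IsOpen V ∧ ∃ K O T, IsCompact K ∧ V ⊆ K ∧ K ⊆ O ∧ IsNormalFrame c O T

theorem IsSmall.subset_source {V : Set (E n)} (hV : IsSmall c V) : V ⊆ c.source := by
  obtain ⟨-, K, O, T, -, hVK, hKO, hT⟩ := hV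
  exact hVK.trans (hKO.trans hT.subset_source)

theorem IsC4Chart.exists_isSmall (hc : IsC4Chart c) {u : E n} (hu : u ∈ c.source) :
    ∃ V, IsSmall c V ∧ u ∈ V := by
  obtain ⟨O, T, huO, hT⟩ := hc.exists_isNormalFrame hu
  obtain ⟨r, hr, hrO⟩ := Metric.nhds_basis_closedBall.mem_iff.1 (hT.isOpen.mem_nhds huO)
  exact ⟨Metric.ball u r, ⟨Metric.isOpen_ball, _, O, T, isCompact_closedBall u r,
    Metric.ball_subset_closedBall, hrO, hT⟩, Metric.mem_ball_self hr⟩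

theorem IsSmall.chartVolume_lt_top (hc : IsC4Chart c) {V : Set (E n)} (hV : IsSmall c V) :
    chartVolume c ((fun u => (c u : E (n + k))) '' V) < ⊤ := by
  obtain ⟨-, K, O, T, hK, hVK, hKO, hT⟩ := hV
  exact (measure_mono (Set.image_mono hVK)).trans_lt
    (hc.chartVolume_image_lt_top hK (hKO.trans hT.subset_source))

theorem IsC4Submanifold.exists_chart (hM : IsC4Submanifold n M) {p : E (n + k)} (hp : p ∈ M) :
    ∃ c : OpenPartialHomeomorph (E n) M, IsC4Chart c ∧ ∃ u ∈ c.source, (c u : E (n + k)) = p := by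
  obtain ⟨c, hc, hpc⟩ := hM ⟨p, hp⟩
  exact ⟨c, hc, c.symm ⟨p, hp⟩, c.map_target hpc, congrArg Subtype.val (c.right_inv hpc)⟩

theorem IsLaplacePotential.normalHessianDet_pos (hf : IsLaplacePotential n M ε f₀ m κ)
    (hM : IsC4Submanifold n M) (hε : 0 < ε) {p : E (n + k)} (hp : p ∈ M) :
    0 < normalHessianDet n M f₀ p := by
  obtain ⟨c, hc, u, hu, rfl⟩ := hM.exists_chart hp
  obtain ⟨O, T, huO, hT⟩ := hc.exists_isNormalFrame hu
  exact hf.normalHessianDet_pos_of_frame hε hc hT huO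

/-- The bases in the definition of the determinant vary without any regularity, so continuity is
read off from the quotient of determinants in a continuous frame. -/
theorem IsLaplacePotential.continuousOn_normalHessianDet (hf : IsLaplacePotential n M ε f₀ m κ)
    (hM : IsC4Submanifold n M) (hε : 0 < ε) : ContinuousOn (normalHessianDet n M f₀) M := by
  rw [continuousOn_iff_continuous_domRestrict, continuous_iff_continuousAt]
  intro p
  obtain ⟨c, hc, hpc⟩ := hM p
  obtain ⟨O, T, huO, hT⟩ := hc.exists_isNormalFrame (c.map_target hpc)
  rw [c.continuousAt_iff_continuousAt_comp_right hpc]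
  have hcO : ContinuousOn (fun u => (c u : E (n + k))) O := hc.continuousOn.mono hT.subset_source
  have hH : ContinuousOn (fun u => fderiv ℝ (fderiv ℝ f₀) (c u : E (n + k))) O :=
    hf.continuousOn_fderiv_fderiv.comp hcO fun u _ => Metric.self_subset_thickening hε M (c u).2
  have hTe : ∀ i, ContinuousOn (fun u => T u (EuclideanSpace.single i 1)) O := fun i =>
    hT.contDiffOn.continuousOn.clm_apply continuousOn_const
  have h1 : ContinuousOn (fun u => (Matrix.of fun i j =>
      frameHessian f₀ c T u (EuclideanSpace.single i 1) (EuclideanSpace.single j 1)).det) O := by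
    refine (continuous_id.matrix_det).comp_continuousOn
      (continuousOn_pi.2 fun i => continuousOn_pi.2 fun j => ?_)
    exact (hH.clm_apply (hTe i)).clm_apply (hTe j)
  have h2 : ContinuousOn (fun u =>
      (Matrix.gram ℝ fun i => T u (EuclideanSpace.single i 1)).det) O := by
    refine (continuous_id.matrix_det).comp_continuousOn
      (continuousOn_pi.2 fun i => continuousOn_pi.2 fun j => ?_)
    exact ContinuousOn.inner (𝕜 := ℝ) (hTe i) (hTe j)
  have h3 := (h1.div h2 fun u hu => (hT.det_gram_pos hu).ne').continuousAt (hT.isOpen.mem_nhds huO)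
  refine h3.congr ?_
  filter_upwards [hT.isOpen.mem_nhds huO] with u hu
  rw [Pi.div_apply, hf.det_frameHessian hε hc hT hu,
    mul_div_cancel_right₀ _ (hT.det_gram_pos hu).ne']
  rfl

/-- The factor `|∂²f₀/∂r²|^{-1/2}` of the limit density. -/
def hessianWeight (n : ℕ) {d : ℕ} (M : Set (E d)) (f : E d → ℝ) (p : E d) : ℝ :=
  |normalHessianDet n M f p| ^ (-(1 / 2) : ℝ)

theorem IsLaplacePotential.hessianWeight_pos (hf : IsLaplacePotential n M ε f₀ m κ)
    (hM : IsC4Submanifold n M) (hε : 0 < ε) {p : E (n + k)} (hp : p ∈ M) :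
    0 < hessianWeight n M f₀ p :=
  Real.rpow_pos_of_pos (abs_pos.2 (hf.normalHessianDet_pos hM hε hp).ne') _

theorem IsLaplacePotential.continuousOn_hessianWeight (hf : IsLaplacePotential n M ε f₀ m κ)
    (hM : IsC4Submanifold n M) (hε : 0 < ε) : ContinuousOn (hessianWeight n M f₀) M :=
  (hf.continuousOn_normalHessianDet hM hε).abs.rpow_const fun _ hp =>
    Or.inl (abs_pos.2 (hf.normalHessianDet_pos hM hε hp).ne').ne'

/-- `IsLaplacePotential.tendsto_setIntegral_tubeOver`, with the limit written as an integral over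
the patch. -/
theorem IsLaplacePotential.tendsto_setIntegral_tubeOver_chart
    (hf : IsLaplacePotential n M ε f₀ m κ) (hM : IsC4Submanifold n M) (hMc : IsCompact M)
    (hε : IsTubularRadius n M ε) (hc : IsC4Chart c) {V : Set (E n)} (hV : IsSmall c V)
    {A : Set (E (n + k))} (hA : MeasurableSet A) (hAV : A ⊆ (fun u => (c u : E (n + k))) '' V)
    {g : ℝ → E (n + k) → ℝ} {g₀ : E (n + k) → ℝ}
    (hgc : ∀ᶠ θ in 𝓝[>] 0, ContinuousOn (g θ) (tube M ε))
    (hg : TendstoUniformlyOn g g₀ (𝓝[>] 0) (tube M ε))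
    (hg₀ : ContinuousOn g₀ (tube M ε)) {C : ℝ} (hC : ∀ x ∈ tube M ε, |g₀ x| ≤ C) :
    MeasurableSet (tubeOver n M ε A) ∧
    Tendsto (fun θ => (√θ ^ k)⁻¹ * ∫ y in tubeOver n M ε A, g θ y * Real.exp (-((f₀ y - m) / θ)))
      (𝓝[>] 0)
      (𝓝 (gaussMass k * ∫ p in A, g₀ p * hessianWeight n M f₀ p ∂chartVolume c)) := by
  have hVs := hV.subset_source
  obtain ⟨-, K, O, T, hK, hVK, hKO, hT⟩ := hV
  set B : Set (E n) := V ∩ (fun u => (c u : E (n + k))) ⁻¹' A with hB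
  have hBs : B = c.source ∩ (fun u => (c u : E (n + k))) ⁻¹' A := by
    refine Set.Subset.antisymm (fun u hu => ⟨hVs hu.1, hu.2⟩) fun u hu => ⟨?_, hu.2⟩
    obtain ⟨v, hv, hvu⟩ := hAV hu.2
    exact injOn_chart (hVs hv) hu.1 hvu ▸ hv
  have hBm : MeasurableSet B := hBs ▸ hc.measurableSet_source_inter_preimage hA
  have hAB : A = (fun u => (c u : E (n + k))) '' B := by
    refine Set.Subset.antisymm (fun p hp => ?_) (by rintro _ ⟨u, hu, rfl⟩; exact hu.2)
    obtain ⟨v, hv, rfl⟩ := hAV hp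
    exact ⟨v, ⟨hv, hp⟩, rfl⟩
  have hBK : B ⊆ K := Set.inter_subset_left.trans hVK
  rw [hAB, hc.setIntegral_chartVolume (F := fun p => g₀ p * hessianWeight n M f₀ p)
    hMc.measurableSet (Set.inter_subset_left.trans hVs) hBm
    ((hg₀.mono (Metric.self_subset_thickening hε.1 M)).mul
      (hf.continuousOn_hessianWeight hM hε.1))]
  exact ⟨hT.measurableSet_tubeOver hc hε (hBK.trans hKO) hBm,
    hf.tendsto_setIntegral_tubeOver hε hc hT hK hKO hBK hBm hgc hg hg₀ hC⟩

/-- Two charts define the same volume on the overlap of small pieces of their patches: the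
integrals of `|∂²f₀/∂r²|^{-1/2}` over a set `A` agree, since both are the limit of the same Laplace
integral over the part of the tube above `A`. -/
theorem IsLaplacePotential.chartVolume_restrict_eq_of_isSmall
    (hf : IsLaplacePotential n M ε f₀ m κ) (hM : IsC4Submanifold n M) (hMc : IsCompact M)
    (hε : IsTubularRadius n M ε) (hc : IsC4Chart c) (hc' : IsC4Chart c') {V V' : Set (E n)}
    (hV : IsSmall c V) (hV' : IsSmall c' V') {P : Set (E (n + k))}
    (hP : P = (fun u => (c u : E (n + k))) '' V ∩ (fun u => (c' u : E (n + k))) '' V') :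
    (chartVolume c).restrict P = (chartVolume c').restrict P := by
  have hPm : MeasurableSet P := hP ▸ (hc.measurableSet_image hV.subset_source
    hV.1.measurableSet).inter (hc'.measurableSet_image hV'.subset_source hV'.1.measurableSet)
  have hPM : P ⊆ M := by
    rw [hP]; rintro _ ⟨⟨u, -, rfl⟩, -⟩; exact (c u).2
  have hwc := hf.continuousOn_hessianWeight hM hε.1
  have hw0 : ∀ p ∈ M, 0 < hessianWeight n M f₀ p := fun p hp => hf.hessianWeight_pos hM hε.1 hp
  obtain ⟨C, hC⟩ := hMc.exists_bound_of_continuousOn hwc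
  have hint : ∀ μ : Measure (E (n + k)), μ P < ⊤ → ∀ A ⊆ P,
      IntegrableOn (hessianWeight n M f₀) A μ := fun μ hμ A hA =>
    (IntegrableOn.of_bound hμ ((hwc.mono hPM).aestronglyMeasurable hPm) C
      (ae_restrict_of_forall_mem hPm fun p hp => hC p (hPM hp))).mono_set hA
  have hμ : chartVolume c P < ⊤ :=
    (measure_mono (hP ▸ Set.inter_subset_left)).trans_lt (hV.chartVolume_lt_top hc)
  have hμ' : chartVolume c' P < ⊤ :=
    (measure_mono (hP ▸ Set.inter_subset_right)).trans_lt (hV'.chartVolume_lt_top hc')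
  have heq : ∀ A ⊆ P, MeasurableSet A → ∫ p in A, hessianWeight n M f₀ p ∂chartVolume c =
      ∫ p in A, hessianWeight n M f₀ p ∂chartVolume c' := by
    intro A hAP hA
    have hAP' := hP ▸ hAP
    have h1 : TendstoUniformlyOn (fun (_ : ℝ) (_ : E (n + k)) => (1 : ℝ)) (fun _ => 1) (𝓝[>] 0)
        (tube M ε) := fun U hU => Eventually.of_forall fun _ _ _ => refl_mem_uniformity hU
    have h2 := (hf.tendsto_setIntegral_tubeOver_chart hM hMc hε hc hV hA
      (hAP'.trans Set.inter_subset_left) (Eventually.of_forall fun _ => continuousOn_const) h1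
      continuousOn_const (C := 1) (by simp)).2
    have h3 := (hf.tendsto_setIntegral_tubeOver_chart hM hMc hε hc' hV' hA
      (hAP'.trans Set.inter_subset_right) (Eventually.of_forall fun _ => continuousOn_const) h1
      continuousOn_const (C := 1) (by simp)).2
    simpa using mul_left_cancel₀ (gaussMass_pos k).ne' (tendsto_nhds_unique h2 h3)
  -- equality of the measures with density `w` is equality of the measures, as `0 < w < ∞` on `P`
  set w : E (n + k) → ENNReal := fun p => ENNReal.ofReal (hessianWeight n M f₀ p) with hw
  have hwd : ((chartVolume c).restrict P).withDensity w =
      ((chartVolume c').restrict P).withDensity w := by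
    have key : ∀ μ : Measure (E (n + k)), μ P < ⊤ → ∀ A, MeasurableSet A →
        (μ.restrict P).withDensity w A =
          ENNReal.ofReal (∫ p in A ∩ P, hessianWeight n M f₀ p ∂μ) := by
      intro μ hμ A hA
      rw [withDensity_apply _ hA, Measure.restrict_restrict hA,
        ofReal_integral_eq_lintegral_ofReal (hint μ hμ _ Set.inter_subset_right)
          (ae_restrict_of_forall_mem (hA.inter hPm) fun p hp => (hw0 p (hPM hp.2)).le)]
    ext A hA
    rw [key _ hμ A hA, key _ hμ' A hA, heq _ Set.inter_subset_right (hA.inter hPm)]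
  have hinv : ∀ μ : Measure (E (n + k)),
      ((μ.restrict P).withDensity w).withDensity w⁻¹ = μ.restrict P := fun μ =>
    withDensity_inv_same₀ ((hwc.mono hPM).aemeasurable hPm).ennreal_ofReal
      (ae_restrict_of_forall_mem hPm fun p hp => by
        simpa [hw] using hw0 p (hPM hp)) (ae_of_all _ fun _ => ENNReal.ofReal_ne_top)
  rw [← hinv, hwd, hinv]

theorem IsLaplacePotential.chartVolume_restrict_eq (hf : IsLaplacePotential n M ε f₀ m κ)
    (hM : IsC4Submanifold n M) (hMc : IsCompact M) (hε : IsTubularRadius n M ε)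
    (hc : IsC4Chart c) (hc' : IsC4Chart c') :
    (chartVolume c).restrict (patch c ∩ patch c') =
      (chartVolume c').restrict (patch c ∩ patch c') := by
  have hcov : ∀ c : OpenPartialHomeomorph (E n) M, IsC4Chart c → ∃ (V : E n → Set (E n))
      (t : Set (E n)), t.Countable ∧ (∀ u ∈ t, IsSmall c (V u)) ∧ c.source ⊆ ⋃ u ∈ t, V u := by
    intro c hc
    choose! V hV using fun u (hu : u ∈ c.source) => hc.exists_isSmall hu
    obtain ⟨t, hts, htc, hst⟩ := TopologicalSpace.countable_cover_nhdsWithin (f := V)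
      (s := c.source) fun u hu =>
        mem_nhdsWithin_of_mem_nhds ((hV u hu).1.1.mem_nhds (hV u hu).2)
    exact ⟨V, t, htc, fun u hu => (hV u (hts hu)).1, hst⟩
  obtain ⟨V, t, htc, hV, hVs⟩ := hcov c hc
  obtain ⟨V', t', htc', hV', hVs'⟩ := hcov c' hc'
  have hsub : patch c ∩ patch c' ⊆ ⋃ q ∈ t ×ˢ t', (fun u => (c u : E (n + k))) '' V q.1 ∩
      (fun u => (c' u : E (n + k))) '' V' q.2 := by
    rintro p ⟨⟨u, hu, rfl⟩, ⟨u', hu', hp⟩⟩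
    obtain ⟨i, hi, hui⟩ := Set.mem_iUnion₂.1 (hVs hu)
    obtain ⟨j, hj, huj⟩ := Set.mem_iUnion₂.1 (hVs' hu')
    exact Set.mem_iUnion₂.2 ⟨(i, j), ⟨hi, hj⟩, ⟨u, hui, rfl⟩, ⟨u', huj, hp⟩⟩
  refine Measure.restrict_congr_mono hsub ((Measure.restrict_biUnion_congr (htc.prod htc')).2 ?_)
  rintro ⟨i, j⟩ ⟨hi, hj⟩
  exact hf.chartVolume_restrict_eq_of_isSmall hM hMc hε hc hc' (hV i hi) (hV' j hj) rfl

theorem IsC4Chart.chartVolume_le (hc : IsC4Chart c) : chartVolume c ≤ riemannianVolume n M :=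
  le_iSup₂ (f := fun (c : OpenPartialHomeomorph (E n) M) (_ : IsC4Chart c) => chartVolume c) c hc

/-- The restriction of the Riemannian volume to `M` already bounds the volumes of all charts, so
it is the whole supremum. -/
theorem riemannianVolume_compl (hMm : MeasurableSet M) : riemannianVolume n M Mᶜ = 0 := by
  have h : riemannianVolume n M ≤ (riemannianVolume n M).restrict M := by
    refine iSup₂_le fun c hc => Measure.le_iff.2 fun S hS => ?_
    rw [Measure.restrict_apply hS, ← hc.chartVolume_inter_patch S]
    exact (measure_mono (Set.inter_subset_inter_right S patch_subset)).trans (hc.chartVolume_le _)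
  refine le_antisymm ((h _).trans ?_) zero_le
  rw [Measure.restrict_apply hMm.compl, Set.compl_inter_self, measure_empty]

/-- On a patch, the Riemannian volume is the volume of the chart: the sum of the latter and of the
Riemannian volume off the patch bounds the volumes of all charts. -/
theorem IsLaplacePotential.riemannianVolume_restrict_patch
    (hf : IsLaplacePotential n M ε f₀ m κ) (hM : IsC4Submanifold n M) (hMc : IsCompact M)
    (hε : IsTubularRadius n M ε) (hc : IsC4Chart c) :
    (riemannianVolume n M).restrict (patch c) = (chartVolume c).restrict (patch c) := by
  refine le_antisymm ?_ (Measure.restrict_mono subset_rfl hc.chartVolume_le)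
  have h : riemannianVolume n M ≤
      chartVolume c + (riemannianVolume n M).restrict (patch c)ᶜ := by
    refine iSup₂_le fun c' hc' => Measure.le_iff.2 fun S hS => ?_
    rw [Measure.add_apply, Measure.restrict_apply hS, ← measure_inter_add_sdiff S
      hc.measurableSet_patch]
    refine add_le_add ?_ (hc'.chartVolume_le _)
    have h1 := congrArg (fun μ => μ (S ∩ patch c))
      (hf.chartVolume_restrict_eq hM hMc hε hc hc')
    simp only [Measure.restrict_apply (hS.inter hc.measurableSet_patch)] at h1
    have h2 : S ∩ patch c ∩ (patch c ∩ patch c') = S ∩ patch c ∩ patch c' := by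
      ext x; simp only [Set.mem_inter_iff]; tauto
    rw [h2] at h1
    rw [← hc'.chartVolume_inter_patch, ← h1]
    exact measure_mono fun x hx => hx.1.1
  refine Measure.le_iff.2 fun S hS => ?_
  rw [Measure.restrict_apply hS, Measure.restrict_apply hS]
  refine (h _).trans ?_
  rw [Measure.add_apply, Measure.restrict_apply (hS.inter hc.measurableSet_patch),
    Set.inter_assoc, Set.inter_compl_self, Set.inter_empty, measure_empty, add_zero]

end

section

/-! ### The Riemannian volume of a compact submanifold -/

theorem IsC4Chart.image_mem_nhdsWithin {d n : ℕ} {M : Set (E d)}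
    {c : OpenPartialHomeomorph (E n) M} {V : Set (E n)} (hV : IsOpen V) {u : E n} (huV : u ∈ V)
    (hu : u ∈ c.source) : (fun u => (c u : E d)) '' V ∈ 𝓝[M] (c u : E d) := by
  rw [nhdsWithin_eq_map_subtype_coe (c u).2]
  have h := image_mem_map (m := ((↑) : M → E d)) (c.image_mem_nhds hu (hV.mem_nhds huV))
  rwa [Set.image_image] at h

variable {n k : ℕ} {M : Set (E (n + k))} {ε m κ : ℝ} {f₀ : E (n + k) → ℝ}

theorem IsLaplacePotential.riemannianVolume_restrict_of_subset
    (hf : IsLaplacePotential n M ε f₀ m κ) (hM : IsC4Submanifold n M) (hMc : IsCompact M)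
    (hε : IsTubularRadius n M ε) {c : OpenPartialHomeomorph (E n) M} (hc : IsC4Chart c)
    {A : Set (E (n + k))} (hA : A ⊆ patch c) :
    (riemannianVolume n M).restrict A = (chartVolume c).restrict A :=
  Measure.restrict_congr_mono hA (hf.riemannianVolume_restrict_patch hM hMc hε hc)

theorem IsLaplacePotential.riemannianVolume_lt_top (hf : IsLaplacePotential n M ε f₀ m κ)
    (hM : IsC4Submanifold n M) (hMc : IsCompact M) (hε : IsTubularRadius n M ε) :
    riemannianVolume n M M < ⊤ := by
  refine hMc.measure_lt_top_of_nhdsWithin fun p hp => ?_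
  obtain ⟨c, hc, u, hu, rfl⟩ := hM.exists_chart hp
  obtain ⟨V, hV, huV⟩ := hc.exists_isSmall hu
  refine ⟨_, IsC4Chart.image_mem_nhdsWithin hV.1 huV hu, ?_⟩
  have h := congrArg (fun μ => μ Set.univ) (hf.riemannianVolume_restrict_of_subset hM hMc hε hc
    (Set.image_mono hV.subset_source))
  simp only [Measure.restrict_apply_univ] at h
  rw [h]
  exact hV.chartVolume_lt_top hc

theorem riemannianVolume_pos (hM : IsC4Submanifold n M) (hne : M.Nonempty) :
    0 < riemannianVolume n M M := by
  obtain ⟨p, hp⟩ := hne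
  obtain ⟨c, hc, u, hu, rfl⟩ := hM.exists_chart hp
  refine lt_of_lt_of_le ?_ ((hc.chartVolume_le (patch c)).trans (measure_mono patch_subset))
  have hs := c.open_source.measurableSet
  rw [patch, ← Measure.restrict_apply_univ, hc.chartVolume_restrict_image subset_rfl hs,
    Measure.map_apply_of_aemeasurable (hc.aemeasurable_chart subset_rfl hs) MeasurableSet.univ,
    Set.preimage_univ, withDensity_apply _ MeasurableSet.univ, Measure.restrict_univ,
    pos_iff_ne_zero]
  intro h0
  rw [lintegral_eq_zero_iff' (hc.aemeasurable_density subset_rfl hs)] at h0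
  have h1 : ∀ᵐ u ∂volume.restrict c.source, False := by
    filter_upwards [h0, ae_restrict_mem hs] with v hv hvs
    have h2 := Real.sqrt_pos.2 (hc.det_metricTensor_pos hvs)
    simp only [Pi.zero_apply, ENNReal.ofReal_eq_zero] at hv
    linarith
  have h2 : volume.restrict c.source = 0 := by simpa using h1
  exact (c.open_source.measure_pos volume ⟨u, hu⟩).ne' (Measure.restrict_eq_zero.1 h2)

theorem riemannianVolume_restrict_self (hMm : MeasurableSet M) :
    (riemannianVolume n M).restrict M = riemannianVolume n M :=
  Measure.restrict_eq_self_of_ae_mem (riemannianVolume_compl hMm)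

theorem IsLaplacePotential.integrableOn_riemannianVolume (hf : IsLaplacePotential n M ε f₀ m κ)
    (hM : IsC4Submanifold n M) (hMc : IsCompact M) (hε : IsTubularRadius n M ε)
    {F : E (n + k) → ℝ} (hF : ContinuousOn F M) : IntegrableOn F M (riemannianVolume n M) := by
  obtain ⟨C, hC⟩ := hMc.exists_bound_of_continuousOn hF
  exact IntegrableOn.of_bound (hf.riemannianVolume_lt_top hM hMc hε)
    (hF.aestronglyMeasurable hMc.measurableSet) C
    (ae_restrict_of_forall_mem hMc.measurableSet hC)

/-! ### The Laplace asymptotics over the tube -/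

theorem tubeOver_self (hε : IsTubularRadius n M ε) : tubeOver n M ε M = tube M ε := by
  rw [← hε.2.image_eq, tubeOver]
  congr 1
  ext q
  exact ⟨fun h => h.1, fun h => ⟨h, h.1⟩⟩

theorem tubeOver_union (A A' : Set (E (n + k))) :
    tubeOver n M ε (A ∪ A') = tubeOver n M ε A ∪ tubeOver n M ε A' := by
  rw [tubeOver, tubeOver, tubeOver, ← Set.image_union]
  congr 1
  ext q
  simp only [Set.mem_ofPred_eq, Set.mem_union]
  tauto

theorem tubeOver_subset (hε : IsTubularRadius n M ε) (A : Set (E (n + k))) :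
    tubeOver n M ε A ⊆ tube M ε := by
  rw [← hε.2.image_eq]
  exact Set.image_mono fun q hq => hq.1

theorem disjoint_tubeOver (hε : IsTubularRadius n M ε) {A A' : Set (E (n + k))}
    (h : Disjoint A A') : Disjoint (tubeOver n M ε A) (tubeOver n M ε A') := by
  rw [Set.disjoint_left]
  rintro _ ⟨q, ⟨hq, hqA⟩, rfl⟩ ⟨q', ⟨hq', hqA'⟩, hqq⟩
  have := hε.2.injOn hq' hq hqq
  exact Set.disjoint_left.1 h hqA (this ▸ hqA')

theorem IsLaplacePotential.le_of_mem_tube (hf : IsLaplacePotential n M ε f₀ m κ)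
    (hε : IsTubularRadius n M ε) {y : E (n + k)} (hy : y ∈ tube M ε) : m ≤ f₀ y := by
  obtain ⟨⟨p, v⟩, ⟨hp, hv, hvε⟩, rfl⟩ := hε.2.surjOn hy
  have h := hf.mul_norm_sq_le hp hv hvε
  have h2 := mul_nonneg hf.pos.le (sq_nonneg ‖v‖)
  simp only at h ⊢
  linarith

theorem IsLaplacePotential.eventually_integrableOn (hf : IsLaplacePotential n M ε f₀ m κ)
    (hMc : IsCompact M) (hε : IsTubularRadius n M ε) {g : ℝ → E (n + k) → ℝ}
    {g₀ : E (n + k) → ℝ} (hgc : ∀ᶠ θ in 𝓝[>] 0, ContinuousOn (g θ) (tube M ε))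
    (hg : TendstoUniformlyOn g g₀ (𝓝[>] 0) (tube M ε)) {C : ℝ}
    (hC : ∀ x ∈ tube M ε, |g₀ x| ≤ C) :
    ∀ᶠ θ in 𝓝[>] (0 : ℝ),
      IntegrableOn (fun y => g θ y * Real.exp (-((f₀ y - m) / θ))) (tube M ε) := by
  have hm : MeasurableSet (tube M ε) := Metric.isOpen_thickening.measurableSet
  filter_upwards [hgc, Metric.tendstoUniformlyOn_iff.1 hg 1 one_pos, self_mem_nhdsWithin]
    with θ h1 h2 hθ
  refine IntegrableOn.of_bound hMc.isBounded.thickening.measure_lt_top ?_ (C + 1)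
    (ae_restrict_of_forall_mem hm fun y hy => ?_)
  · exact (h1.mul (Real.continuous_exp.comp_continuousOn
      ((hf.contDiffOn.continuousOn.sub continuousOn_const).div_const
        θ).neg)).aestronglyMeasurable hm
  · have h3 := h2 y hy
    rw [dist_comm, Real.dist_eq] at h3
    have h4 : |g θ y| ≤ C + 1 := by
      calc |g θ y| = |(g θ y - g₀ y) + g₀ y| := by rw [sub_add_cancel]
        _ ≤ |g θ y - g₀ y| + |g₀ y| := abs_add_le _ _
        _ ≤ C + 1 := by linarith [hC y hy]
    have h5 : Real.exp (-((f₀ y - m) / θ)) ≤ 1 := by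
      rw [Real.exp_le_one_iff, neg_nonpos]
      exact div_nonneg (sub_nonneg.2 (hf.le_of_mem_tube hε hy)) (le_of_lt hθ)
    rw [norm_mul, Real.norm_of_nonneg (Real.exp_pos _).le, Real.norm_eq_abs]
    exact (mul_le_of_le_one_right (abs_nonneg _) h5).trans h4

/-- Laplace asymptotics over the tube. The contributions of the parts of the tube above disjoint
pieces of `M` add up, and `M` is covered by finitely many small pieces of patches. -/
theorem IsLaplacePotential.tendsto_setIntegral_tube
    (hf : IsLaplacePotential n M ε f₀ m κ) (hM : IsC4Submanifold n M) (hMc : IsCompact M)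
    (hε : IsTubularRadius n M ε) {g : ℝ → E (n + k) → ℝ} {g₀ : E (n + k) → ℝ}
    (hgc : ∀ᶠ θ in 𝓝[>] 0, ContinuousOn (g θ) (tube M ε))
    (hg : TendstoUniformlyOn g g₀ (𝓝[>] 0) (tube M ε))
    (hg₀ : ContinuousOn g₀ (tube M ε)) {C : ℝ} (hC : ∀ x ∈ tube M ε, |g₀ x| ≤ C) :
    Tendsto (fun θ => (√θ ^ k)⁻¹ * ∫ y in tube M ε, g θ y * Real.exp (-((f₀ y - m) / θ)))
      (𝓝[>] 0)
      (𝓝 (gaussMass k * ∫ p, g₀ p * hessianWeight n M f₀ p ∂riemannianVolume n M)) := by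
  have hloc : ∀ p ∈ M, ∃ U ∈ 𝓝[M] p, ∃ c : OpenPartialHomeomorph (E n) M, ∃ V,
      IsC4Chart c ∧ IsSmall c V ∧ U = (fun u => (c u : E (n + k))) '' V := by
    intro p hp
    obtain ⟨c, hc, u, hu, rfl⟩ := hM.exists_chart hp
    obtain ⟨V, hV, huV⟩ := hc.exists_isSmall hu
    exact ⟨_, IsC4Chart.image_mem_nhdsWithin hV.1 huV hu, c, V, hc, hV, rfl⟩
  choose! U hU hUc using hloc
  obtain ⟨t, htM, htU⟩ := hMc.elim_nhdsWithin_subcover U hU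
  have hUm : ∀ p ∈ M, MeasurableSet (U p) := fun p hp => by
    obtain ⟨c, V, hc, hV, h⟩ := hUc p hp
    exact h ▸ hc.measurableSet_image hV.subset_source hV.1.measurableSet
  have hFi : IntegrableOn (fun p => g₀ p * hessianWeight n M f₀ p) M (riemannianVolume n M) :=
    hf.integrableOn_riemannianVolume hM hMc hε
      ((hg₀.mono (Metric.self_subset_thickening hε.1 M)).mul
        (hf.continuousOn_hessianWeight hM hε.1))
  have key : ∀ s : Finset (E (n + k)), (∀ p ∈ s, p ∈ M) → ∀ A, MeasurableSet A → A ⊆ M →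
      A ⊆ ⋃ p ∈ s, U p → MeasurableSet (tubeOver n M ε A) ∧
      Tendsto (fun θ => (√θ ^ k)⁻¹ *
          ∫ y in tubeOver n M ε A, g θ y * Real.exp (-((f₀ y - m) / θ))) (𝓝[>] 0)
        (𝓝 (gaussMass k * ∫ p in A, g₀ p * hessianWeight n M f₀ p ∂riemannianVolume n M)) := by
    classical
    intro s
    induction s using Finset.induction_on with
    | empty =>
      intro _ A _ _ hA
      have hA0 : A = ∅ := by simpa using hA
      have h0 : tubeOver n M ε (∅ : Set (E (n + k))) = ∅ := by simp [tubeOver]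
      rw [hA0, h0]
      simp
    | insert q s _ ih =>
      intro hs A hAm hAM hA
      have hqM : q ∈ M := hs q (Finset.mem_insert_self q s)
      obtain ⟨c, V, hc, hV, hUq⟩ := hUc q hqM
      have hA1V : A ∩ U q ⊆ (fun u => (c u : E (n + k))) '' V := hUq ▸ Set.inter_subset_right
      have h1 := hf.tendsto_setIntegral_tubeOver_chart hM hMc hε hc hV (hAm.inter (hUm q hqM))
        hA1V hgc hg hg₀ hC
      rw [← hf.riemannianVolume_restrict_of_subset hM hMc hε hc
        (hA1V.trans (Set.image_mono hV.subset_source))] at h1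
      have h2 := ih (fun p hp => hs p (Finset.mem_insert_of_mem hp)) (A \ U q)
        (MeasurableSet.diff hAm (hUm q hqM)) (Set.sdiff_subset.trans hAM) fun p hp => by
          have h3 := hA hp.1
          rw [Finset.set_biUnion_insert] at h3
          exact h3.resolve_left hp.2
      have hdisj : Disjoint (A ∩ U q) (A \ U q) := Set.disjoint_sdiff_inter.symm
      have hAeq : tubeOver n M ε A = tubeOver n M ε (A ∩ U q) ∪ tubeOver n M ε (A \ U q) := by
        rw [← tubeOver_union, Set.inter_union_sdiff]
      refine ⟨hAeq ▸ h1.1.union h2.1, ?_⟩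
      have hval : ∫ p in A, g₀ p * hessianWeight n M f₀ p ∂riemannianVolume n M =
          (∫ p in A ∩ U q, g₀ p * hessianWeight n M f₀ p ∂riemannianVolume n M) +
          ∫ p in A \ U q, g₀ p * hessianWeight n M f₀ p ∂riemannianVolume n M :=
        (integral_inter_add_sdiff (hUm q hqM) (hFi.mono_set hAM)).symm
      rw [hval, mul_add]
      refine (h1.2.add h2.2).congr' ?_
      filter_upwards [hf.eventually_integrableOn hMc hε hgc hg hC] with θ hθ
      rw [hAeq, setIntegral_union (disjoint_tubeOver hε hdisj) h2.1
        (hθ.mono_set (tubeOver_subset hε _)) (hθ.mono_set (tubeOver_subset hε _)), mul_add]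
  have h := (key t htM M hMc.measurableSet subset_rfl htU).2
  rwa [tubeOver_self hε, riemannianVolume_restrict_self hMc.measurableSet] at h

/-! ### Weak convergence of the Gibbs measures -/

/-- The hypotheses on `f_θ = f₀ + θ f₁ + o(θ)` turn `exp (-f_θ / θ)` into `exp (-f₀ / θ)` times
a factor converging uniformly to `exp (-f₁)`. -/
theorem tendstoUniformlyOn_mul_exp {X : Type*} {S : Set X} {f : ℝ → X → ℝ} {f₀ f₁ h : X → ℝ}
    {C : ℝ} (hC : ∀ x ∈ S, |h x * Real.exp (-f₁ x)| ≤ C)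
    (hrem : ∀ η : ℝ, 0 < η → ∀ᶠ θ in 𝓝[>] (0 : ℝ), ∀ x ∈ S, |f θ x - f₀ x - θ * f₁ x| ≤ η * θ) :
    TendstoUniformlyOn (fun θ x => h x * Real.exp (-((f θ x - f₀ x) / θ)))
      (fun x => h x * Real.exp (-f₁ x)) (𝓝[>] 0) S := by
  rw [Metric.tendstoUniformlyOn_iff]
  intro δ hδ
  set η : ℝ := min 1 (δ / (2 * (|C| + 1))) with hη
  have hη0 : 0 < η := lt_min one_pos (by positivity)
  filter_upwards [hrem η hη0, self_mem_nhdsWithin] with θ hθ hpos x hx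
  have hpos' : 0 < θ := hpos
  set r : ℝ := -((f θ x - f₀ x - θ * f₁ x) / θ) with hr
  have hrη : |r| ≤ η := by
    rw [hr, abs_neg, abs_div, abs_of_pos hpos', div_le_iff₀ hpos']
    exact hθ x hx
  have hexp : Real.exp (-((f θ x - f₀ x) / θ)) = Real.exp (-f₁ x) * Real.exp r := by
    rw [← Real.exp_add]
    congr 1
    rw [hr]
    field_simp
    ring
  have h1 := Real.abs_exp_sub_one_le (hrη.trans (min_le_left _ _))
  rw [dist_comm, Real.dist_eq, hexp]
  calc |h x * (Real.exp (-f₁ x) * Real.exp r) - h x * Real.exp (-f₁ x)|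
      = |h x * Real.exp (-f₁ x)| * |Real.exp r - 1| := by rw [← abs_mul]; congr 1; ring
    _ ≤ |C| * (2 * η) := mul_le_mul ((hC x hx).trans (le_abs_self C))
        (h1.trans (by linarith)) (abs_nonneg _) (abs_nonneg _)
    _ < (|C| + 1) * (2 * η) := by nlinarith
    _ ≤ (|C| + 1) * (2 * (δ / (2 * (|C| + 1)))) := by
        gcongr
        exact min_le_right _ _
    _ = δ := by field_simp

section
variable {d : ℕ} {F : E d → ℝ} {θ : ℝ}

theorem gibbsDensity_nonneg (x : E d) : 0 ≤ gibbsDensity F θ x :=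
  div_nonneg (Real.exp_pos _).le (integral_nonneg fun _ => (Real.exp_pos _).le)

theorem integrable_gibbsDensity (hF : Integrable fun x => Real.exp (-F x / θ)) :
    Integrable (gibbsDensity F θ) := hF.div_const _

theorem integral_gibbsDensity (hF : Integrable fun x => Real.exp (-F x / θ)) :
    ∫ x, gibbsDensity F θ x = 1 := by
  simp only [gibbsDensity]
  rw [integral_div, div_self (integral_exp_pos hF).ne']

theorem isProbabilityMeasure_gibbsMeasure (hF : Integrable fun x => Real.exp (-F x / θ)) :
    IsProbabilityMeasure (gibbsMeasure F θ) := by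
  refine ⟨?_⟩
  rw [gibbsMeasure, withDensity_apply _ MeasurableSet.univ, Measure.restrict_univ,
    ← ofReal_integral_eq_lintegral_ofReal (integrable_gibbsDensity hF)
      (ae_of_all _ gibbsDensity_nonneg), integral_gibbsDensity hF, ENNReal.ofReal_one]

theorem integral_gibbsMeasure (hF : Integrable fun x => Real.exp (-F x / θ)) (h : E d → ℝ) :
    ∫ x, h x ∂gibbsMeasure F θ = ∫ x, h x * gibbsDensity F θ x := by
  rw [gibbsMeasure, integral_withDensity_eq_integral_toReal_smul₀
    (integrable_gibbsDensity hF).aemeasurable.ennreal_ofReal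
    (ae_of_all _ fun _ => ENNReal.ofReal_lt_top)]
  congr 1 with x
  rw [ENNReal.toReal_ofReal (gibbsDensity_nonneg x), smul_eq_mul, mul_comm]

/-- The mass of the Gibbs measure off a set bounds the error made by restricting an integral to
that set. -/
theorem abs_integral_gibbsMeasure_sub_le (hF : Integrable fun x => Real.exp (-F x / θ))
    (h : BoundedContinuousFunction (E d) ℝ) {S : Set (E d)} (hS : MeasurableSet S) :
    |(∫ x, h x ∂gibbsMeasure F θ) - ∫ x in S, h x * gibbsDensity F θ x| ≤
      ‖h‖ * (1 - ∫ x in S, gibbsDensity F θ x) := by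
  have hi := integrable_gibbsDensity hF
  have hhi : Integrable fun x => h x * gibbsDensity F θ x :=
    hi.bdd_mul h.continuous.aestronglyMeasurable (ae_of_all _ h.norm_coe_le_norm)
  rw [integral_gibbsMeasure hF, ← integral_gibbsDensity hF, ← integral_add_compl hS hhi,
    ← integral_add_compl hS hi, add_sub_cancel_left, add_sub_cancel_left, ← integral_const_mul]
  have hbd : Integrable (fun x => ‖h‖ * gibbsDensity F θ x) (volume.restrict Sᶜ) :=
    Integrable.const_mul hi.integrableOn ‖h‖
  rw [← Real.norm_eq_abs]
  refine norm_integral_le_of_norm_le hbd (ae_of_all _ fun x => ?_)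
  rw [norm_mul, Real.norm_of_nonneg (gibbsDensity_nonneg x)]
  exact mul_le_mul_of_nonneg_right (h.norm_coe_le_norm x) (gibbsDensity_nonneg x)

end

theorem IsLaplacePotential.integral_unnormalizedLimit (hf : IsLaplacePotential n M ε f₀ m κ)
    (hM : IsC4Submanifold n M) (hMc : IsCompact M) (hε : IsTubularRadius n M ε)
    {f₁ : E (n + k) → ℝ} (hf₁ : ContinuousOn f₁ M) (h : E (n + k) → ℝ) :
    ∫ p, h p ∂unnormalizedLimit n M f₀ f₁ =
      ∫ p, h p * Real.exp (-f₁ p) * hessianWeight n M f₀ p ∂riemannianVolume n M := by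
  have hi := hf.integrableOn_riemannianVolume hM hMc hε
    ((Real.continuous_exp.comp_continuousOn hf₁.neg).mul (hf.continuousOn_hessianWeight hM hε.1))
  rw [IntegrableOn, riemannianVolume_restrict_self hMc.measurableSet] at hi
  rw [unnormalizedLimit, integral_withDensity_eq_integral_toReal_smul₀
    (f := fun p => ENNReal.ofReal (Real.exp (-f₁ p) * |normalHessianDet n M f₀ p| ^ (-(1 / 2) : ℝ)))
    hi.aemeasurable.ennreal_ofReal (ae_of_all _ fun _ => ENNReal.ofReal_lt_top)]
  congr 1 with x
  rw [ENNReal.toReal_ofReal (mul_nonneg (Real.exp_pos _).le (Real.rpow_nonneg (abs_nonneg _) _)),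
    smul_eq_mul, hessianWeight]
  ring

theorem IsLaplacePotential.unnormalizedLimit_univ (hf : IsLaplacePotential n M ε f₀ m κ)
    (hM : IsC4Submanifold n M) (hMc : IsCompact M) (hε : IsTubularRadius n M ε)
    (hne : M.Nonempty) {f₁ : E (n + k) → ℝ} (hf₁ : ContinuousOn f₁ M) :
    0 < ∫ p, Real.exp (-f₁ p) * hessianWeight n M f₀ p ∂riemannianVolume n M ∧
    unnormalizedLimit n M f₀ f₁ Set.univ = ENNReal.ofReal
      (∫ p, Real.exp (-f₁ p) * hessianWeight n M f₀ p ∂riemannianVolume n M) := by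
  have hself := riemannianVolume_restrict_self (n := n) hMc.measurableSet
  have hi : IntegrableOn (fun p => Real.exp (-f₁ p) * hessianWeight n M f₀ p) M
      (riemannianVolume n M) := hf.integrableOn_riemannianVolume hM hMc hε
    ((Real.continuous_exp.comp_continuousOn hf₁.neg).mul (hf.continuousOn_hessianWeight hM hε.1))
  rw [IntegrableOn, hself] at hi
  have hnn : ∀ p, 0 ≤ Real.exp (-f₁ p) * hessianWeight n M f₀ p := fun p =>
    mul_nonneg (Real.exp_pos _).le (Real.rpow_nonneg (abs_nonneg _) _)
  constructor
  · refine (integral_pos_iff_support_of_nonneg_ae (ae_of_all _ hnn) hi).2 ?_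
    refine (riemannianVolume_pos hM hne).trans_le (measure_mono fun p hp => ?_)
    exact (mul_pos (Real.exp_pos _) (hf.hessianWeight_pos hM hε.1 hp)).ne'
  · rw [unnormalizedLimit, withDensity_apply _ MeasurableSet.univ, Measure.restrict_univ,
      ofReal_integral_eq_lintegral_ofReal hi (ae_of_all _ hnn)]
    simp only [hessianWeight]

/-- The convergence of the Gibbs measures. The mass of the tube tends to one, and the normalising
constants cancel in the quotient of two Laplace integrals over the tube. -/
theorem IsLaplacePotential.tendsto_integral_gibbsMeasure (hf : IsLaplacePotential n M ε f₀ m κ)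
    (hM : IsC4Submanifold n M) (hMc : IsCompact M) (hε : IsTubularRadius n M ε)
    (hne : M.Nonempty) {f : ℝ → E (n + k) → ℝ} {f₁ : E (n + k) → ℝ}
    (hrem : ∀ η : ℝ, 0 < η → ∀ᶠ θ in 𝓝[>] (0 : ℝ), ∀ x ∈ tube M ε,
      |f θ x - f₀ x - θ * f₁ x| ≤ η * θ)
    (hf₁ : ContinuousOn f₁ (closure (tube M ε)))
    (hfc : ∀ᶠ θ in 𝓝[>] (0 : ℝ), ContinuousOn (f θ) (tube M ε))
    (hint : ∀ᶠ θ in 𝓝[>] (0 : ℝ), Integrable fun x => Real.exp (-f θ x / θ))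
    (hconc : Tendsto (fun θ => 1 - ∫ x in tube M ε, gibbsDensity (f θ) θ x) (𝓝[>] (0 : ℝ)) (𝓝 0))
    (h : BoundedContinuousFunction (E (n + k)) ℝ) :
    Tendsto (fun θ => ∫ x, h x ∂gibbsMeasure (f θ) θ) (𝓝[>] (0 : ℝ))
      (𝓝 (∫ x, h x ∂limitMeasure n M f₀ f₁)) := by
  have hm : MeasurableSet (tube M ε) := Metric.isOpen_thickening.measurableSet
  have hf₁t : ContinuousOn f₁ (tube M ε) := hf₁.mono subset_closure
  have hf₁M : ContinuousOn f₁ M := hf₁t.mono (Metric.self_subset_thickening hε.1 M)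
  have hcpt : IsCompact (closure (tube M ε)) := hMc.isBounded.thickening.isCompact_closure
  obtain ⟨C, hC⟩ := hcpt.exists_bound_of_continuousOn (f := fun x => Real.exp (-f₁ x))
    (Real.continuous_exp.comp_continuousOn hf₁.neg)
  have hlap : ∀ h : BoundedContinuousFunction (E (n + k)) ℝ,
      Tendsto (fun θ => (√θ ^ k)⁻¹ * ∫ y in tube M ε, h y * Real.exp (-((f θ y - f₀ y) / θ)) *
        Real.exp (-((f₀ y - m) / θ))) (𝓝[>] 0)
      (𝓝 (gaussMass k * ∫ p, h p * Real.exp (-f₁ p) * hessianWeight n M f₀ p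
        ∂riemannianVolume n M)) := by
    intro h
    have hb : ∀ x ∈ tube M ε, |h x * Real.exp (-f₁ x)| ≤ ‖h‖ * C := fun x hx => by
      rw [abs_mul]
      exact mul_le_mul (h.norm_coe_le_norm x) (hC x (subset_closure hx)) (abs_nonneg _)
        (norm_nonneg _)
    refine hf.tendsto_setIntegral_tube hM hMc hε (hfc.mono fun θ hθ => ?_)
      (tendstoUniformlyOn_mul_exp hb hrem)
      (h.continuous.continuousOn.mul (Real.continuous_exp.comp_continuousOn hf₁t.neg)) hb
    exact h.continuous.continuousOn.mul (Real.continuous_exp.comp_continuousOn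
      ((hθ.sub hf.contDiffOn.continuousOn).div_const θ).neg)
  set N : BoundedContinuousFunction (E (n + k)) ℝ → ℝ → ℝ := fun h θ =>
    ∫ x in tube M ε, h x * gibbsDensity (f θ) θ x with hN
  set I : BoundedContinuousFunction (E (n + k)) ℝ → ℝ → ℝ := fun h θ =>
    (√θ ^ k)⁻¹ * ∫ y in tube M ε, h y * Real.exp (-((f θ y - f₀ y) / θ)) *
        Real.exp (-((f₀ y - m) / θ)) with hI
  -- the same factor relates both pairs, as `exp (-f_θ / θ)` is the product of the exponentials
  have hNI : ∀ h, ∀ᶠ θ in 𝓝[>] (0 : ℝ),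
      N h θ = √θ ^ k * Real.exp (-m / θ) / (∫ y, Real.exp (-f θ y / θ)) * I h θ := by
    intro h
    filter_upwards [self_mem_nhdsWithin] with θ hθ
    have hθ' : 0 < θ := hθ
    have hk : √θ ^ k ≠ 0 := (pow_pos (Real.sqrt_pos.2 hθ') k).ne'
    simp only [hN, hI]
    rw [← mul_assoc, ← integral_const_mul]
    congr 1 with y
    have he : Real.exp (-f θ y / θ) = Real.exp (-m / θ) *
        (Real.exp (-((f θ y - f₀ y) / θ)) * Real.exp (-((f₀ y - m) / θ))) := by
      rw [← Real.exp_add, ← Real.exp_add]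
      congr 1
      field_simp
      ring
    rw [gibbsDensity, he]
    field_simp
  set one : BoundedContinuousFunction (E (n + k)) ℝ := BoundedContinuousFunction.const _ 1
  obtain ⟨hpos, huniv⟩ := hf.unnormalizedLimit_univ hM hMc hε hne hf₁M
  set Z := ∫ p, Real.exp (-f₁ p) * hessianWeight n M f₀ p ∂riemannianVolume n M with hZ
  have hI1 : Tendsto (I one) (𝓝[>] 0) (𝓝 (gaussMass k * Z)) := by
    simpa [one, hI] using hlap one
  have hgZ : 0 < gaussMass k * Z := mul_pos (gaussMass_pos k) hpos
  have hN1 : Tendsto (N one) (𝓝[>] 0) (𝓝 1) := by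
    have := (tendsto_const_nhds (x := (1 : ℝ))).sub hconc
    simpa [hN, one] using this
  have hNh : Tendsto (N h) (𝓝[>] 0) (𝓝 (∫ x, h x ∂limitMeasure n M f₀ f₁)) := by
    have h1 := hN1.mul ((hlap h).div hI1 hgZ.ne')
    have hval : 1 * (gaussMass k * (∫ p, h p * Real.exp (-f₁ p) * hessianWeight n M f₀ p
        ∂riemannianVolume n M) / (gaussMass k * Z)) = ∫ x, h x ∂limitMeasure n M f₀ f₁ := by
      rw [limitMeasure, integral_smul_measure, hf.integral_unnormalizedLimit hM hMc hε hf₁M,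
        huniv, ENNReal.toReal_inv, ENNReal.toReal_ofReal hpos.le, smul_eq_mul, one_mul,
        mul_div_mul_left _ _ (gaussMass_pos k).ne', div_eq_inv_mul]
    rw [hval] at h1
    refine h1.congr' ?_
    filter_upwards [hNI h, hNI one, hI1.eventually (lt_mem_nhds hgZ)] with θ h2 h3 h4
    have h5 : I one θ ≠ 0 := ne_of_gt h4
    change N one θ * (I h θ / I one θ) = N h θ
    rw [h2, h3]
    field_simp
  have hdiff : Tendsto (fun θ => (∫ x, h x ∂gibbsMeasure (f θ) θ) - N h θ) (𝓝[>] 0) (𝓝 0) := by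
    refine squeeze_zero_norm' (a := fun θ => ‖h‖ *
      (1 - ∫ x in tube M ε, gibbsDensity (f θ) θ x)) ?_ (by simpa using hconc.const_mul ‖h‖)
    filter_upwards [hint] with θ hθ using abs_integral_gibbsMeasure_sub_le hθ h hm
  simpa using hdiff.add hNh

theorem IsLaplacePotential.isProbabilityMeasure_limitMeasure
    (hf : IsLaplacePotential n M ε f₀ m κ) (hM : IsC4Submanifold n M) (hMc : IsCompact M)
    (hε : IsTubularRadius n M ε) (hne : M.Nonempty) {f₁ : E (n + k) → ℝ}
    (hf₁ : ContinuousOn f₁ M) : IsProbabilityMeasure (limitMeasure n M f₀ f₁) := by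
  obtain ⟨hpos, huniv⟩ := hf.unnormalizedLimit_univ hM hMc hε hne hf₁
  refine ⟨?_⟩
  rw [limitMeasure, Measure.smul_apply, smul_eq_mul, huniv]
  exact ENNReal.inv_mul_cancel (ENNReal.ofReal_pos.2 hpos).ne' ENNReal.ofReal_ne_top

end

end LaplaceManifold

end

open LaplaceManifold in
theorem mainTheorem3 (d n : ℕ) (hnd : n < d)
    -- the manifold and its tube
    (M : Set (E d)) (hMc : IsCompact M) (hM : IsC4Submanifold n M)
    (ε : ℝ) (hε : IsTubularRadius n M ε)
    -- the functions `f_θ = f₀ + θ f₁ + o(θ)`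
    (f : ℝ → E d → ℝ) (f₀ f₁ : E d → ℝ)
    -- `M` is the set of minimisers of `f₀` on the tube, with a gap away from `M`
    (hmin : ∀ x, x ∈ M ↔ x ∈ tube M ε ∧ IsMinOn f₀ (tube M ε) x)
    (hgap : ∃ ε' : ℝ, 0 < ε' ∧ ε' < ε ∧ ∃ c : ℝ, 0 < c ∧
      ∀ x ∈ tube M ε \ closure (tube M ε'), ∀ p ∈ M, c ≤ f₀ x - f₀ p)
    -- the remainder is `o(θ)`, uniformly on the tube
    (hrem : ∀ η : ℝ, 0 < η → ∀ᶠ θ in 𝓝[>] (0 : ℝ), ∀ x ∈ tube M ε,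
      |f θ x - f₀ x - θ * f₁ x| ≤ η * θ)
    -- regularity
    (hf₀_nonneg : ∀ x ∈ closure (tube M ε), 0 ≤ f₀ x)
    (hf₀ : ContDiffOn ℝ 3 f₀ (closure (tube M ε)))
    (hf₁ : ContDiffOn ℝ 1 f₁ (closure (tube M ε)))
    (hf : ∀ᶠ θ in 𝓝[>] (0 : ℝ), ContinuousOn (f θ) (closure (tube M ε)))
    -- the smallest eigenvalue of the normal Hessian is bounded away from zero on the tube
    (hHess : ∃ c : ℝ, 0 < c ∧ ∀ p ∈ M, ∀ v : normalSpace n M p, ‖v‖ < ε →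
      ∀ w : normalSpace n M p, c * ‖w‖ ^ 2 ≤ normalHessian n M f₀ p v w w)
    -- `exp (-f_θ / θ)` can be normalised, and the mass concentrates in the tube
    (hint : ∀ᶠ θ in 𝓝[>] (0 : ℝ), Integrable fun x : E d => Real.exp (-f θ x / θ))
    (hconc : Tendsto (fun θ => 1 - ∫ x in tube M ε, gibbsDensity (f θ) θ x)
      (𝓝[>] (0 : ℝ)) (𝓝 0)) :
    -- weak convergence of probability measures
    (∀ᶠ θ in 𝓝[>] (0 : ℝ), IsProbabilityMeasure (gibbsMeasure (f θ) θ)) ∧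
      IsProbabilityMeasure (limitMeasure n M f₀ f₁) ∧
      ∀ h : BoundedContinuousFunction (E d) ℝ,
        Tendsto (fun θ => ∫ x, h x ∂(gibbsMeasure (f θ) θ)) (𝓝[>] (0 : ℝ))
          (𝓝 (∫ x, h x ∂(limitMeasure n M f₀ f₁))) := by

  obtain ⟨k, rfl⟩ := Nat.exists_eq_add_of_le hnd.le
  have hMt : M ⊆ tube M ε := Metric.self_subset_thickening hε.1 M
  have hne : M.Nonempty := by
    by_contra hM0
    rw [Set.not_nonempty_iff_eq_empty] at hM0
    -- over the empty tube the integral in `hconc` vanishes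
    simp [hM0] at hconc
  obtain ⟨p₀, hp₀⟩ := hne
  obtain ⟨κ, hκ, hHess⟩ := hHess
  have hf₀2 : ContDiffOn ℝ 2 f₀ (tube M ε) := (hf₀.mono subset_closure).of_le (by norm_num)
  have hmin' : ∀ p ∈ M, IsMinOn f₀ (tube M ε) p := fun p hp => ((hmin p).1 hp).2
  have hL : IsLaplacePotential n M ε f₀ (f₀ p₀) κ :=
    { contDiffOn := hf₀2
      eq_of_mem := fun p hp => le_antisymm (hmin' p hp (hMt hp₀)) (hmin' p₀ hp₀ (hMt hp))
      fderiv_eq_zero := fun p hp => ((hmin' p hp).isLocalMin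
        (Metric.isOpen_thickening.mem_nhds (hMt hp))).fderiv_eq_zero
      pos := hκ
      le_hessian := fun p hp v hv hvε w hw => by
        have h1 := hHess p hp ⟨v, hv⟩ hvε ⟨w, hw⟩
        rwa [normalHessian_apply hf₀2 hp ⟨v, hv⟩ hvε] at h1 }
  have hf₁c := hf₁.continuousOn
  exact ⟨hint.mono fun θ hθ => isProbabilityMeasure_gibbsMeasure hθ,
    hL.isProbabilityMeasure_limitMeasure hM hMc hε ⟨p₀, hp₀⟩
      (hf₁c.mono (hMt.trans subset_closure)),
    hL.tendsto_integral_gibbsMeasure hM hMc hε ⟨p₀, hp₀⟩ hrem hf₁c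
      (hf.mono fun θ hθ => hθ.mono subset_closure) hint hconc⟩
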